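/- Let $d\ge 1$, let $A\subseteq\mathbb R^d$ and let $\mathcal S$ be a Borel measure on $A$ (extended by zero to $\mathbb R^d$), and assume one of the following two conditions. (a) $d=1$, $A=\{x_k : k\in N\}$ for a finite or infinite sequence $(x_k)_{k\in N}$, $N\subseteq\mathbb N$, of real numbers such that every $y\in\mathbb R$ has a neighbourhood containing $x_k$ for only finitely many $k\in N$, and $\mathcal S=\sum_{k\in N}\delta_{x_k}$. (b) $d\ge 2$, $A=\partial U$ for a bounded open set $U\subseteq\mathbb R^d$ with Lipschitz boundary, and $\mathcal S$ is the $(d-1)$-dimensional Hausdorff (surface) measure $H^{d-1}$ on $A$, normalized to agree with Lebesgue measure on $\mathbb R^{d-1}$. Here $U$ has Lipschitz boundary if $\partial U$ is covered by finitely many open sets $U_1,\dots,U_l$, where for each $k$ there are an orthonormal basis $e^k_1,\dots,e^k_d$, a number $h_k>0$, an open cuboid $I_k\subseteq\mathbb R^{d-1}$ and a Lipschitz function $\varphi_k:\mathbb R^{d-1}\to\mathbb R$ such that, writing $v=\sum_j v_je^k_j$, $v'=(v_1,\dots,v_{d-1})$ and $s_k(v)=v_d-\varphi_k(v')$, one has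 $U_k=\{v: v'\in I_k,\ |s_k(v)|<h_k\}$, and each $v\in U_k$ lies in $\partial U$ if $s_k(v)=0$, in $U$ if $s_k(v)>0$, and in $\mathbb R^d\setminus\overline U$ if $s_k(v)<0$. Let $\mu=\lambda^d+\mathcal S$, where $\lambda^d$ is Lebesgue measure, and let $\varrho:\mathbb R^d\to(0,\infty)$ be continuously differentiable and $\mu$-integrable. Let $(\mathcal E^\varrho,D(\mathcal E^\varrho))$ be the closure on the real Hilbert space $L^2(\mathbb R^d,\varrho\mu)$ of the bilinear form $$\mathcal E^\varrho(f,g)=\int_{\mathbb R^d}\langle\nabla f,\nabla g\rangle\,\varrho\,d\lambda^d,\qquad f,g\in C_c^\infty(\mathbb R^d).$$ Then $(\mathcal E^\varrho,D(\mathcal E^\varrho))$ is irreducible: if $(T_t)_{t>0}$ is the strongly continuous semigroup on $L^2(\mathbb R^d,\varrho\mu)$ associated with this form and $B\subseteq\mathbb R^d$ is a Borel set with $T_t(\mathbf 1_Bf)=\mathbf 1_B\,T_tf$ $\varrho\mu$-a.e. for all $t>0$ and all $f\in L^2(\mathbb R^d,\varrho\mu)$, then $\varrho\mu(B)=0$ or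 $\varrho\mu(\mathbb R^d\setminus B)=0$. -/

import Mathlib

open MeasureTheory Filter Topology Set
open scoped ContDiff ENNReal NNReal InnerProductSpace

noncomputable section

namespace StickyForm

/-- Euclidean space of dimension `d = n + 1`. -/
abbrev Sp (n : ℕ) : Type := EuclideanSpace ℝ (Fin (n + 1))

/-! ### The semigroup of a symmetric form and irreducibility -/

section Semigroup

variable {H : Type*} [NormedAddCommGroup H] [InnerProductSpace ℝ H]

/-- `u` is the orbit `t ↦ T_t f` of the semigroup of the symmetric form `(a, D)` on `H`: it is
continuous on `[0, ∞)`, starts at `f`, and for `t > 0` it is differentiable with `u' = L u`, where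
`L` is the generator: `w ∈ D(L)`, `L w = z` means `w ∈ D` and `a(w, v) = -⟪z, v⟫` for `v ∈ D`.
For a densely defined closed nonnegative form, every `f` has exactly one orbit. -/
def IsOrbit (D : Set H) (a : H → H → ℝ) (f : H) (u : ℝ → H) : Prop :=
  ContinuousOn u (Ici 0) ∧ u 0 = f ∧
    ∀ t : ℝ, 0 < t → u t ∈ D ∧
      ∃ z : H, HasDerivAt u z t ∧ ∀ v ∈ D, a (u t) v = -⟪z, v⟫_ℝ

open Classical in
/-- `T_t f`, the strongly continuous semigroup of the closed symmetric form `(a, D)`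
(the value `0` is never used for a densely defined closed nonnegative form). -/
def semigroup (D : Set H) (a : H → H → ℝ) (t : ℝ) (f : H) : H :=
  if h : ∃ u, IsOrbit D a f u then h.choose t else 0

end Semigroup

/-- Multiplication by `1_B` on `L²(m)`. -/
def cutoff {X : Type*} [MeasurableSpace X] {m : Measure X} {B : Set X} (hB : MeasurableSet B)
    (f : Lp ℝ 2 m) : Lp ℝ 2 m :=
  ((Lp.memLp f).indicator hB).toLp (B.indicator f)

/-- `B` is an invariant set: `T_t (1_B f) = 1_B T_t f` for all `t > 0` and `f ∈ L²(m)`. -/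
def IsInvariant {X : Type*} [MeasurableSpace X] {m : Measure X}
    (D : Set (Lp ℝ 2 m)) (a : Lp ℝ 2 m → Lp ℝ 2 m → ℝ) {B : Set X} (hB : MeasurableSet B) : Prop :=
  ∀ t : ℝ, 0 < t → ∀ f : Lp ℝ 2 m,
    semigroup D a t (cutoff hB f) = cutoff hB (semigroup D a t f)

/-- The form `(a, D)` on `L²(m)` is irreducible: every invariant set is null or conull. -/
def IsIrreducible {X : Type*} [MeasurableSpace X] {m : Measure X}
    (D : Set (Lp ℝ 2 m)) (a : Lp ℝ 2 m → Lp ℝ 2 m → ℝ) : Prop :=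
  ∀ (B : Set X) (hB : MeasurableSet B), IsInvariant D a hB → m B = 0 ∨ m Bᶜ = 0

/-! ### The form -/

/-- The measure `ϱ μ` with `μ = λ^d + S`. -/
def weighted {n : ℕ} (ρ : Sp n → ℝ) (S : Measure (Sp n)) : Measure (Sp n) :=
  (volume + S).withDensity fun x => ENNReal.ofReal (ρ x)

/-- Smooth functions with compact support. -/
def IsTest {n : ℕ} (φ : Sp n → ℝ) : Prop :=
  ContDiff ℝ ∞ φ ∧ HasCompactSupport φ

/-- `∫ ⟨∇φ, ∇ψ⟩ ϱ dλ^d`, for smooth compactly supported `φ`, `ψ`. -/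
def preForm {n : ℕ} (ρ : Sp n → ℝ) (φ ψ : Sp n → ℝ) : ℝ :=
  ∫ x, ⟪gradient φ x, gradient ψ x⟫_ℝ * ρ x

/-- `φ k` are test functions which are Cauchy for the form and converge to `f` in `L²(ϱ μ)`. -/
def IsApprox {n : ℕ} (ρ : Sp n → ℝ) (S : Measure (Sp n)) (f : Lp ℝ 2 (weighted ρ S))
    (φ : ℕ → Sp n → ℝ) : Prop :=
  (∀ k, IsTest (φ k)) ∧
    (∀ ε : ℝ, 0 < ε → ∃ N : ℕ, ∀ j ≥ N, ∀ k ≥ N, preForm ρ (φ j - φ k) (φ j - φ k) < ε) ∧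
    Tendsto (fun k => eLpNorm (φ k - ⇑f) 2 (weighted ρ S)) atTop (𝓝 0)

/-- The domain of the closure of `(preForm, C_c^∞)` on `L²(ϱ μ)`. -/
def formDomain {n : ℕ} (ρ : Sp n → ℝ) (S : Measure (Sp n)) : Set (Lp ℝ 2 (weighted ρ S)) :=
  {f | ∃ φ, IsApprox ρ S f φ}

open Classical in
/-- The closure of `(preForm, C_c^∞)`: the limit of `preForm` along approximating sequences, and
`0` outside of the domain. -/
def form {n : ℕ} (ρ : Sp n → ℝ) (S : Measure (Sp n)) (f g : Lp ℝ 2 (weighted ρ S)) : ℝ :=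
  if h : (∃ φ, IsApprox ρ S f φ) ∧ (∃ ψ, IsApprox ρ S g ψ) then
    limUnder atTop fun k => preForm ρ (h.1.choose k) (h.2.choose k)
  else 0

/-! ### The two choices of `A` and `S` -/

/-- Dimension one: `A = {x_k : k ∈ N}` for a finite or infinite sequence of points `(x_k)_{k ∈ N}`,
`N ⊆ ℕ`, which does not accumulate, and `S = ∑_{k ∈ N} δ_{x_k}`. -/
def IsPointCase {n : ℕ} (A : Set (Sp n)) (S : Measure (Sp n)) : Prop :=
  n = 0 ∧ ∃ (N : Set ℕ) (x : ℕ → Sp n),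
    (∀ y : Sp n, ∃ ε : ℝ, 0 < ε ∧ {k ∈ N | dist (x k) y < ε}.Finite) ∧
    A = x '' N ∧
    S = Measure.sum fun k : N => Measure.dirac (x k)

/-- The data of a local graph: an orthonormal basis, a height, an open cuboid and a Lipschitz
function of the first `n = d - 1` coordinates. -/
structure GraphChart (n : ℕ) where
  basis : OrthonormalBasis (Fin (n + 1)) ℝ (Sp n)
  height : ℝ
  height_pos : 0 < height
  lo : Fin n → ℝ
  hi : Fin n → ℝ
  graph : EuclideanSpace ℝ (Fin n) → ℝ
  lipschitz : ∃ K : ℝ≥0, LipschitzWith K graph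

namespace GraphChart

variable {n : ℕ} (c : GraphChart n)

/-- The first `d - 1` coordinates with respect to the basis of the chart. -/
def base (v : Sp n) : EuclideanSpace ℝ (Fin n) :=
  WithLp.toLp 2 fun j => c.basis.repr v j.castSucc

/-- The last coordinate minus the value of the graph function. -/
def offset (v : Sp n) : ℝ := c.basis.repr v (Fin.last n) - c.graph (c.base v)

/-- The open set described by the chart. -/
def dom : Set (Sp n) :=
  {v | (∀ j, c.lo j < c.base v j ∧ c.base v j < c.hi j) ∧ |c.offset v| < c.height}

end GraphChart

/-- `∂U` is covered by finitely many charts in which it is the graph of a Lipschitz function, with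
`U` above the graph and the complement of the closure of `U` below it. -/
def HasLipschitzBoundary {n : ℕ} (U : Set (Sp n)) : Prop :=
  ∃ (l : ℕ) (c : Fin l → GraphChart n),
    (∀ k, ∀ v ∈ (c k).dom,
      ((c k).offset v = 0 → v ∈ frontier U) ∧
      (0 < (c k).offset v → v ∈ U) ∧
      ((c k).offset v < 0 → v ∈ (closure U)ᶜ)) ∧
    frontier U ⊆ ⋃ k, (c k).dom

/-- Dimension `d = n + 1 ≥ 2`: `A = ∂U` for a bounded open `U` with Lipschitz boundary and `S` is
the `(d - 1)`-dimensional Hausdorff measure on `A`, normalized so that it agrees with Lebesgue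
measure on `ℝ^(d-1)`. -/
def IsLipschitzCase {n : ℕ} (A : Set (Sp n)) (S : Measure (Sp n)) : Prop :=
  1 ≤ n ∧ ∃ U : Set (Sp n), IsOpen U ∧ Bornology.IsBounded U ∧ HasLipschitzBoundary U ∧
    A = frontier U ∧
    S = (Measure.euclideanHausdorffMeasure n).restrict A

end StickyForm

end

noncomputable section

namespace StickyForm

set_option linter.unusedSectionVars false

/-! Let H be L²(ϱμ), let E be the closure of the test functions paired with their gradients
(`EnergySpace`), and let J = `toFn` : E → H. The gradient component is a weak gradient for Lebesgue
measure, so it vanishes with the function; hence J is injective, which is closability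
(`injective_toFn`). The closed form is the inner product of E minus that of H (`form_toFn`), so J J*
is the resolvent (1 - L)⁻¹ of the generator L. The semigroup is a function of this positive
contraction, obtained by complexifying H and using the continuous functional calculus
(`exists_isOrbit`).

If multiplication by 1_B commutes with the semigroup, it commutes with the resolvent
(`resolvent_comm`), hence acts on E and is symmetric for the energy: ∫⟨∇(1_B f), ∇g⟩ϱ = ∫⟨∇f, ∇(1_B
g)⟩ϱ (`exists_cutoff_energySpace`). For f = φ and g = x_j φ the second-order terms cancel after
integration by parts, leaving ∫_B ∂_j(ϱφ²) = 0 (`setIntegral_partialDeriv_sq`). Polarization,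
mollification and division by ϱ give ∫_B ∂_j η = 0 for all compactly supported C¹ functions η, so
1_B is constant Lebesgue almost everywhere.

It remains to control S on a Lebesgue null set B. There 1_B φ lies in E with zero gradient, so it is
a limit of test functions ψ_k tending to zero in H¹ near each chart. The trace inequality
(`GraphChart.lintegral_trace_le`) makes ψ_k tend to zero in L²(S) on the graph, while ψ_k also tends
to 1_B φ there; hence S(B) = 0 (`measure_inter_chart_eq_zero`). A point of the line is treated as a
chart with zero-dimensional base. If B is conull, the same argument applies to its complement. -/

/-! ### Functional calculus of a positive contraction on a real Hilbert space -/

section FunctionalCalculus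

/-- The complexification of a real inner product space. -/
def Complexification (H : Type*) : Type _ := WithLp 2 (H × H)

namespace Complexification

variable {H : Type*} [NormedAddCommGroup H] [InnerProductSpace ℝ H]

instance : NormedAddCommGroup (Complexification H) :=
  inferInstanceAs (NormedAddCommGroup (WithLp 2 (H × H)))

instance [CompleteSpace H] : CompleteSpace (Complexification H) :=
  inferInstanceAs (CompleteSpace (WithLp 2 (H × H)))

/-- The vector `x + i y`. -/
def pair (x y : H) : Complexification H := WithLp.toLp 2 (x, y)

/-- The real part. -/
def re (z : Complexification H) : H := (WithLp.ofLp z).1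

/-- The imaginary part. -/
def im (z : Complexification H) : H := (WithLp.ofLp z).2

@[simp] theorem re_pair (x y : H) : re (pair x y) = x := rfl
@[simp] theorem im_pair (x y : H) : im (pair x y) = y := rfl
@[simp] theorem re_add (z w : Complexification H) : re (z + w) = re z + re w := rfl
@[simp] theorem im_add (z w : Complexification H) : im (z + w) = im z + im w := rfl
@[simp] theorem re_zero : re (0 : Complexification H) = 0 := rfl
@[simp] theorem im_zero : im (0 : Complexification H) = 0 := rfl

@[ext] theorem ext {z w : Complexification H} (h : re z = re w) (h' : im z = im w) : z = w :=
  (WithLp.ofLp_injective 2) (Prod.ext h h')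

theorem norm_sq (z : Complexification H) : ‖z‖ ^ 2 = ‖re z‖ ^ 2 + ‖im z‖ ^ 2 :=
  WithLp.prod_norm_sq_eq_of_L2 (α := H) (β := H) z

instance : SMul ℂ (Complexification H) :=
  ⟨fun c z => pair (c.re • re z - c.im • im z) (c.re • im z + c.im • re z)⟩

@[simp] theorem re_smul (c : ℂ) (z : Complexification H) :
    re (c • z) = c.re • re z - c.im • im z := rfl
@[simp] theorem im_smul (c : ℂ) (z : Complexification H) :
    im (c • z) = c.re • im z + c.im • re z := rfl

instance : Module ℂ (Complexification H) where
  one_smul z := by ext <;> simp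
  mul_smul c d z := by
    ext <;> simp only [re_smul, im_smul, Complex.mul_re, Complex.mul_im] <;> module
  smul_zero c := by ext <;> simp
  smul_add c z w := by ext <;> simp <;> module
  add_smul c d z := by ext <;> simp <;> module
  zero_smul z := by ext <;> simp

theorem norm_smul_eq (c : ℂ) (z : Complexification H) : ‖c • z‖ = ‖c‖ * ‖z‖ := by
  rw [← pow_left_inj₀ (norm_nonneg _) (by positivity) two_ne_zero]
  rw [mul_pow, norm_sq, norm_sq, re_smul, im_smul, norm_sub_sq_real, norm_add_sq_real,
    Complex.sq_norm, Complex.normSq_apply]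
  simp only [norm_smul, inner_smul_left, inner_smul_right, mul_pow, Real.norm_eq_abs, sq_abs,
    real_inner_comm (re z) (im z), conj_trivial]
  ring

instance : InnerProductSpace ℂ (Complexification H) where
  norm_smul_le c z := (norm_smul_eq c z).le
  inner z w := ⟨⟪re z, re w⟫_ℝ + ⟪im z, im w⟫_ℝ, ⟪re z, im w⟫_ℝ - ⟪im z, re w⟫_ℝ⟩
  norm_sq_eq_re_inner z := by simp [norm_sq]
  conj_inner_symm z w := by
    apply Complex.ext <;> simp [real_inner_comm]
  add_left z w v := by
    apply Complex.ext <;> simp [inner_add_left] <;> ring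
  smul_left z w c := by
    apply Complex.ext <;> simp [inner_add_left, inner_sub_left, inner_smul_left] <;> ring

@[simp] theorem re_real_smul (c : ℝ) (z : Complexification H) : re (c • z) = c • re z := by
  rw [← Complex.coe_smul, re_smul]; simp

@[simp] theorem im_real_smul (c : ℝ) (z : Complexification H) : im (c • z) = c • im z := by
  rw [← Complex.coe_smul, im_smul]; simp

theorem inner_def (z w : Complexification H) : ⟪z, w⟫_ℂ =
    ⟨⟪re z, re w⟫_ℝ + ⟪im z, im w⟫_ℝ, ⟪re z, im w⟫_ℝ - ⟪im z, re w⟫_ℝ⟩ := rfl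

theorem norm_pair_zero (x : H) : ‖pair x 0‖ = ‖x‖ := by
  rw [← pow_left_inj₀ (norm_nonneg _) (norm_nonneg _) two_ne_zero, norm_sq]; simp

theorem norm_re_le (z : Complexification H) : ‖re z‖ ≤ ‖z‖ := by
  rw [← pow_le_pow_iff_left₀ (norm_nonneg _) (norm_nonneg _) two_ne_zero, norm_sq z]
  linarith [sq_nonneg ‖im z‖]

/-- The complexification of an operator. -/
def lift (R : H →L[ℝ] H) : Complexification H →L[ℂ] Complexification H :=
  LinearMap.mkContinuous
    { toFun := fun z => pair (R (re z)) (R (im z))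
      map_add' := fun z w => by ext <;> simp
      map_smul' := fun c z => by ext <;> simp } ‖R‖ fun z => by
    rw [← pow_le_pow_iff_left₀ (norm_nonneg _) (by positivity) two_ne_zero, mul_pow, norm_sq,
      norm_sq, mul_add, ← mul_pow, ← mul_pow]
    exact add_le_add (pow_le_pow_left₀ (norm_nonneg _) (R.le_opNorm _) 2)
      (pow_le_pow_left₀ (norm_nonneg _) (R.le_opNorm _) 2)

@[simp] theorem re_lift (R : H →L[ℝ] H) (z : Complexification H) : re (lift R z) = R (re z) := rfl
@[simp] theorem im_lift (R : H →L[ℝ] H) (z : Complexification H) : im (lift R z) = R (im z) := rfl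

theorem lift_pair_zero (R : H →L[ℝ] H) (x : H) : lift R (pair x 0) = pair (R x) 0 := by ext <;> simp

theorem norm_lift_le (R : H →L[ℝ] H) : ‖lift R‖ ≤ ‖R‖ := LinearMap.mkContinuous_norm_le _ (norm_nonneg _) _

variable [CompleteSpace H]

theorem lift_nonneg {R : H →L[ℝ] H} (hR : R.IsPositive) : 0 ≤ lift R := by
  rw [ContinuousLinearMap.nonneg_iff_isPositive, ContinuousLinearMap.isPositive_iff_complex]
  intro z
  have h : ∀ x y, ⟪R x, y⟫_ℝ = ⟪x, R y⟫_ℝ := fun x y => hR.isSymmetric x y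
  -- Symmetry of `R` is what makes the complex quadratic form real-valued.
  have h1 : ⟪R (re z), im z⟫_ℝ - ⟪R (im z), re z⟫_ℝ = 0 := by
    rw [h (im z), real_inner_comm, sub_self]
  refine ⟨?_, ?_⟩
  · rw [inner_def]
    apply Complex.ext <;> simp [h1]
  · rw [inner_def]
    exact add_nonneg (hR.inner_nonneg_left _) (hR.inner_nonneg_left _)

end Complexification

open Complexification

variable {H : Type*} [NormedAddCommGroup H] [InnerProductSpace ℝ H] [CompleteSpace H]

/-- The functional calculus of an operator on a real Hilbert space. -/
def calculus (R : H →L[ℝ] H) (f : ℝ → ℝ) : H →L[ℝ] H :=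
  LinearMap.mkContinuous
    { toFun := fun x => re (cfc f (lift R) (pair x 0))
      map_add' := fun x y => by
        rw [← re_add, ← map_add]; congr 2; ext <;> simp
      map_smul' := fun c x => by
        have : pair (c • x) 0 = (c : ℂ) • pair x 0 := by ext <;> simp
        rw [this, map_smul, Complex.coe_smul, re_real_smul]; rfl } ‖cfc f (lift R)‖ fun x => by
    refine (norm_re_le _).trans ((ContinuousLinearMap.le_opNorm _ _).trans ?_)
    rw [norm_pair_zero]

theorem calculus_apply (R : H →L[ℝ] H) (f : ℝ → ℝ) (x : H) :
    calculus R f x = re (cfc f (lift R) (pair x 0)) := rfl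

variable {R : H →L[ℝ] H} (hR : R.IsPositive) (hR1 : ‖R‖ ≤ 1) {f g : ℝ → ℝ}

include hR hR1 in
theorem spectrum_lift_subset : spectrum ℝ (lift R) ⊆ Icc 0 1 := fun r hr => by
  -- Bounding the spectrum by the operator norm requires ‖1‖ = 1, hence a nontrivial space.
  rcases subsingleton_or_nontrivial (Complexification H) with h | h
  · exact absurd hr (by rw [spectrum.of_subsingleton]; simp)
  have h1 : ‖(1 : Complexification H →L[ℂ] Complexification H)‖ = 1 := norm_one
  have := spectrum.norm_le_norm_of_mem hr
  exact ⟨spectrum_nonneg_of_nonneg (lift_nonneg hR) hr,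
    (le_abs_self r).trans (this.trans ((norm_lift_le R).trans hR1))⟩

include hR hR1

/-- The spectrum lies in [0, 1], so operator estimates reduce to scalar inequalities there. -/
theorem norm_calculus_le {M : ℝ} (hM : 0 ≤ M) (h : ∀ r ∈ Icc (0 : ℝ) 1, |f r| ≤ M) :
    ‖calculus R f‖ ≤ M :=
  (LinearMap.mkContinuous_norm_le _ (norm_nonneg _) _).trans
    (norm_cfc_le hM fun r hr => h r (spectrum_lift_subset hR hR1 hr))

theorem calculus_sub (hf : ContinuousOn f (Icc 0 1)) (hg : ContinuousOn g (Icc 0 1)) :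
    calculus R (fun r => f r - g r) = calculus R f - calculus R g := by
  ext x
  have hs := spectrum_lift_subset hR hR1
  simp only [sub_apply, calculus_apply]
  rw [cfc_sub f g _ (hf.mono hs) (hg.mono hs)]
  rfl

theorem calculus_const_mul (c : ℝ) (hf : ContinuousOn f (Icc 0 1)) :
    calculus R (fun r => c * f r) = c • calculus R f := by
  ext x
  have hs := spectrum_lift_subset hR hR1
  simp only [smul_apply, calculus_apply]
  rw [cfc_const_mul c f _ (hf.mono hs)]
  exact re_real_smul c _

theorem calculus_id_mul (hf : ContinuousOn f (Icc 0 1)) (x : H) :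
    calculus R (fun r => r * f r) x = R (calculus R f x) := by
  have hs := spectrum_lift_subset hR hR1
  have hsa : IsSelfAdjoint (lift R) := .of_nonneg (lift_nonneg hR)
  simp only [calculus_apply]
  rw [cfc_mul (fun r => r) f _ continuousOn_id (hf.mono hs), cfc_id' ℝ (lift R)]
  rfl

theorem calculus_mul_id (hf : ContinuousOn f (Icc 0 1)) (x : H) :
    calculus R (fun r => f r * r) x = calculus R f (R x) := by
  have hs := spectrum_lift_subset hR hR1
  have hsa : IsSelfAdjoint (lift R) := .of_nonneg (lift_nonneg hR)
  simp only [calculus_apply]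
  rw [cfc_mul f (fun r => r) _ (hf.mono hs) continuousOn_id, cfc_id' ℝ (lift R),
    ← lift_pair_zero]
  rfl

theorem calculus_id (x : H) : calculus R (fun r => r) x = R x := by
  have hsa : IsSelfAdjoint (lift R) := .of_nonneg (lift_nonneg hR)
  rw [calculus_apply, cfc_id' ℝ (lift R)]
  rfl

end FunctionalCalculus

/-! ### The semigroup as a function of the resolvent -/

section HeatSymbol

/-- `exp (-t (1/r - 1)) / r`: in terms of `r = 1 / (1 + λ)`, this is `(1 + λ) exp (-t λ)`. -/
def heatSymbol (t r : ℝ) : ℝ := r⁻¹ * Real.exp (-(t * (r⁻¹ - 1)))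

theorem sq_mul_exp_neg_le {x : ℝ} (hx : 0 ≤ x) : x ^ 2 * Real.exp (-x) ≤ 2 := by
  have := Real.quadratic_le_exp_of_nonneg hx
  rw [Real.exp_neg, ← div_eq_mul_inv, div_le_iff₀ (Real.exp_pos _)]
  nlinarith

/-- The inequality x² exp(-x) ≤ 2 at x = t/r. The linear bound gives continuity at r = 0, where the
convention 0⁻¹ = 0 assigns the symbol its limit 0. -/
theorem abs_heatSymbol_le {t r : ℝ} (ht : 0 < t) (hr : r ∈ Icc (0 : ℝ) 1) :
    |heatSymbol t r| ≤ Real.exp t * (2 / t ^ 2) * r := by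
  rcases hr.1.eq_or_lt with rfl | h0
  · simp [heatSymbol]
  have h1 := sq_mul_exp_neg_le (x := t * r⁻¹) (by positivity)
  rw [abs_of_nonneg (by unfold heatSymbol; positivity), heatSymbol,
    show -(t * (r⁻¹ - 1)) = t + -(t * r⁻¹) by ring, Real.exp_add]
  have h2 : r⁻¹ * (Real.exp t * Real.exp (-(t * r⁻¹))) =
      Real.exp t * ((t * r⁻¹) ^ 2 * Real.exp (-(t * r⁻¹))) * (r / t ^ 2) := by
    field_simp
  rw [h2, show Real.exp t * (2 / t ^ 2) * r = Real.exp t * 2 * (r / t ^ 2) by ring]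
  gcongr

theorem continuousOn_heatSymbol {t : ℝ} (ht : 0 < t) : ContinuousOn (heatSymbol t) (Icc 0 1) := by
  intro r hr
  rcases hr.1.eq_or_lt with rfl | h0
  · have h : Tendsto (fun r : ℝ => Real.exp t * (2 / t ^ 2) * r) (𝓝[Icc 0 1] 0) (𝓝 0) := by
      have : Continuous fun r : ℝ => Real.exp t * (2 / t ^ 2) * r := by fun_prop
      simpa using (this.tendsto 0).mono_left nhdsWithin_le_nhds
    have h2 : Tendsto (heatSymbol t) (𝓝[Icc 0 1] 0) (𝓝 0) :=
      squeeze_zero_norm' (eventually_mem_nhdsWithin.mono fun r hr => abs_heatSymbol_le ht hr) h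
    simpa [ContinuousWithinAt, heatSymbol] using h2
  · apply ContinuousAt.continuousWithinAt
    unfold heatSymbol
    fun_prop (disch := exact h0.ne')

theorem abs_id_mul_heatSymbol_le {t r : ℝ} (ht : 0 < t) (hr : r ∈ Icc (0 : ℝ) 1) :
    |r * heatSymbol t r| ≤ 1 := by
  rcases hr.1.eq_or_lt with rfl | h0
  · simp
  have : 1 ≤ r⁻¹ := (one_le_inv₀ h0).2 hr.2
  rw [heatSymbol, mul_inv_cancel_left₀ h0.ne', abs_of_pos (Real.exp_pos _), Real.exp_le_one_iff]
  nlinarith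

/-- With r = 1/(1+λ), the quantity is (exp(-tλ) - 1)/(1+λ), and 1 - exp(-tλ) ≤ tλ. -/
theorem abs_heatSymbol_sub_le {t r : ℝ} (ht : 0 < t) (hr : r ∈ Icc (0 : ℝ) 1) :
    |r * heatSymbol t r * r - r| ≤ t := by
  rcases hr.1.eq_or_lt with rfl | h0
  · simpa using ht.le
  have h1 : 1 ≤ r⁻¹ := (one_le_inv₀ h0).2 hr.2
  have h3 : Real.exp (-(t * (r⁻¹ - 1))) ≤ 1 := Real.exp_le_one_iff.2 (by nlinarith)
  have h4 := Real.add_one_le_exp (-(t * (r⁻¹ - 1)))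
  have h5 : t * (r⁻¹ - 1) * r = t * (1 - r) := by field_simp
  rw [heatSymbol, mul_inv_cancel_left₀ h0.ne', abs_le]
  constructor <;> nlinarith [hr.2]

theorem abs_exp_sub_le (z : ℝ) : |Real.exp z - 1 - z| ≤ z ^ 2 * Real.exp |z| := by
  have := Complex.norm_exp_sub_sum_le_norm_mul_exp z 2
  simp only [Finset.sum_range_succ, Finset.range_zero, Finset.sum_empty] at this
  norm_num at this
  rw [← Complex.ofReal_exp, ← Complex.ofReal_one, ← Complex.ofReal_add, ← Complex.ofReal_sub,
    Complex.norm_real, Real.norm_eq_abs] at this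
  rwa [sub_sub]

/-- The difference quotients of `t ↦ exp (-t (1/r - 1))` converge uniformly in `r`. -/
theorem abs_heatSymbol_taylor_le {δ s r : ℝ} (hδ : 0 < δ) (hs : |s - 2 * δ| ≤ δ)
    (hr : r ∈ Icc (0 : ℝ) 1) :
    |(r * heatSymbol s r - r * heatSymbol (2 * δ) r) -
      (s - 2 * δ) * (r * heatSymbol (2 * δ) r - heatSymbol (2 * δ) r)| ≤
      2 / δ ^ 2 * (s - 2 * δ) ^ 2 := by
  rcases hr.1.eq_or_lt with rfl | h0
  · simp [heatSymbol]; positivity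
  have h1 : 1 ≤ r⁻¹ := (one_le_inv₀ h0).2 hr.2
  simp only [heatSymbol, mul_inv_cancel_left₀ h0.ne']
  -- Here y is the spectral value of -L. Centring at 2δ with |h| ≤ δ lets exp(-2δy) absorb the
  -- factor exp(δy) of the Taylor remainder; the remaining exp(-δy) dominates y².
  obtain ⟨y, hy⟩ : ∃ y, y = r⁻¹ - 1 := ⟨_, rfl⟩
  obtain ⟨h, hh⟩ : ∃ h, h = s - 2 * δ := ⟨_, rfl⟩
  have hy0 : 0 ≤ y := by linarith
  rw [← hh] at hs ⊢
  rw [show s = 2 * δ + h by linarith, show r⁻¹ = y + 1 by linarith]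
  have e1 : -((2 * δ + h) * (y + 1 - 1)) = -(2 * δ * y) + -(h * y) := by ring
  rw [e1, Real.exp_add]
  have e2 : Real.exp (-(2 * δ * y)) * Real.exp (-(h * y)) - Real.exp (-(2 * δ * (y + 1 - 1))) -
      h * (Real.exp (-(2 * δ * (y + 1 - 1))) - (y + 1) * Real.exp (-(2 * δ * (y + 1 - 1)))) =
      Real.exp (-(2 * δ * y)) * (Real.exp (-(h * y)) - 1 - -(h * y)) := by
    rw [show y + 1 - 1 = y by ring]; ring
  rw [e2, abs_mul, abs_of_pos (Real.exp_pos _)]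
  have h2 := abs_exp_sub_le (-(h * y))
  have h3 : |-(h * y)| ≤ δ * y := by
    rw [abs_neg, abs_mul, abs_of_nonneg hy0]; exact mul_le_mul_of_nonneg_right hs hy0
  have h4 := sq_mul_exp_neg_le (x := δ * y) (by positivity)
  calc Real.exp (-(2 * δ * y)) * |Real.exp (-(h * y)) - 1 - -(h * y)|
      ≤ Real.exp (-(2 * δ * y)) * ((-(h * y)) ^ 2 * Real.exp (δ * y)) := by
        refine mul_le_mul_of_nonneg_left (h2.trans ?_) (Real.exp_pos _).le
        exact mul_le_mul_of_nonneg_left (Real.exp_le_exp.2 h3) (sq_nonneg _)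
    _ = h ^ 2 * y ^ 2 * Real.exp (-(δ * y)) := by
        have : Real.exp (-(δ * y)) = Real.exp (-(2 * δ * y)) * Real.exp (δ * y) := by
          rw [← Real.exp_add]; congr 1; ring
        rw [this]; ring
    _ = ((δ * y) ^ 2 * Real.exp (-(δ * y))) * (h ^ 2 / δ ^ 2) := by field_simp
    _ ≤ 2 * (h ^ 2 / δ ^ 2) := mul_le_mul_of_nonneg_right h4 (by positivity)
    _ = 2 / δ ^ 2 * h ^ 2 := by ring

end HeatSymbol

/-! ### Orbits constructed from the resolvent -/

section Orbit

variable {H : Type*} [NormedAddCommGroup H] [InnerProductSpace ℝ H] [CompleteSpace H]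
  {R : H →L[ℝ] H} (hR : R.IsPositive) (hR1 : ‖R‖ ≤ 1)

include hR hR1

/-- On the symbol side, -λ exp(-tλ) = exp(-tλ) - (1+λ) exp(-tλ); the Taylor error is quadratic
uniformly on the spectrum. -/
theorem hasDerivAt_calculus {t : ℝ} (ht : 0 < t) (f : H) :
    HasDerivAt (fun s => R (calculus R (heatSymbol s) f))
      (R (calculus R (heatSymbol t) f) - calculus R (heatSymbol t) f) t := by
  obtain ⟨δ, rfl⟩ : ∃ δ, t = 2 * δ := ⟨t / 2, by ring⟩
  have hδ : 0 < δ := by linarith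
  have hc : ∀ s, 0 < s → ContinuousOn (fun r => r * heatSymbol s r) (Icc 0 1) := fun s hs =>
    continuousOn_id.mul (continuousOn_heatSymbol hs)
  have hk : ContinuousOn (fun r => r * heatSymbol (2 * δ) r - heatSymbol (2 * δ) r) (Icc 0 1) :=
    (hc _ ht).fun_sub (continuousOn_heatSymbol ht)
  rw [hasDerivAt_iff_isLittleO]
  have hO : (fun s => R (calculus R (heatSymbol s) f) - R (calculus R (heatSymbol (2 * δ)) f) -
      (s - 2 * δ) • (R (calculus R (heatSymbol (2 * δ)) f) - calculus R (heatSymbol (2 * δ)) f))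
      =O[𝓝 (2 * δ)] fun s => (s - 2 * δ) ^ 2 := by
    refine Asymptotics.IsBigO.of_bound (2 / δ ^ 2 * ‖f‖) ?_
    filter_upwards [Metric.closedBall_mem_nhds (2 * δ) hδ] with s hs
    rw [Metric.mem_closedBall, Real.dist_eq] at hs
    have hs0 : 0 < s := by linarith [(abs_le.1 hs).1]
    have e : R (calculus R (heatSymbol s) f) - R (calculus R (heatSymbol (2 * δ)) f) -
        (s - 2 * δ) • (R (calculus R (heatSymbol (2 * δ)) f) - calculus R (heatSymbol (2 * δ)) f)
        = calculus R (fun r => (r * heatSymbol s r - r * heatSymbol (2 * δ) r) -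
      (s - 2 * δ) * (r * heatSymbol (2 * δ) r - heatSymbol (2 * δ) r)) f := by
      rw [calculus_sub hR hR1 ((hc s hs0).fun_sub (hc _ ht)) (continuousOn_const.fun_mul hk),
        calculus_const_mul hR hR1 _ hk, calculus_sub hR hR1 (hc s hs0) (hc _ ht),
        calculus_sub hR hR1 (hc _ ht) (continuousOn_heatSymbol ht)]
      simp only [sub_apply, smul_apply,
        calculus_id_mul hR hR1 (continuousOn_heatSymbol ht),
        calculus_id_mul hR hR1 (continuousOn_heatSymbol hs0)]
    rw [e, Real.norm_of_nonneg (sq_nonneg _)]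
    refine (ContinuousLinearMap.le_opNorm _ _).trans ?_
    refine (mul_le_mul_of_nonneg_right (norm_calculus_le hR hR1 (by positivity) fun r hr =>
      abs_heatSymbol_taylor_le hδ hs hr) (norm_nonneg _)).trans_eq (by ring)
  refine hO.trans_isLittleO ?_
  simpa using Asymptotics.isLittleO_pow_sub_sub (2 * δ) one_lt_two

theorem norm_heat_le {t : ℝ} (ht : 0 < t) (f : H) : ‖R (calculus R (heatSymbol t) f)‖ ≤ ‖f‖ := by
  rw [← calculus_id_mul hR hR1 (continuousOn_heatSymbol ht)]
  refine (ContinuousLinearMap.le_opNorm _ _).trans ?_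
  exact mul_le_of_le_one_left (norm_nonneg _) (norm_calculus_le hR hR1 zero_le_one
    fun r hr => abs_id_mul_heatSymbol_le ht hr)

theorem norm_heat_sub_le {t : ℝ} (ht : 0 < t) (f : H) :
    ‖R (calculus R (heatSymbol t) (R f)) - R f‖ ≤ t * ‖f‖ := by
  have h1 := continuousOn_heatSymbol ht
  have h2 : ContinuousOn (fun r => r * heatSymbol t r) (Icc 0 1) := continuousOn_id.mul h1
  have : R (calculus R (heatSymbol t) (R f)) - R f =
      calculus R (fun r => r * heatSymbol t r * r - r) f := by
    rw [calculus_sub hR hR1 (h2.fun_mul (continuousOn_id' _)) (continuousOn_id' _), sub_apply,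
      calculus_mul_id hR hR1 h2, calculus_id_mul hR hR1 h1, calculus_id hR hR1]
  rw [this]
  exact (ContinuousLinearMap.le_opNorm _ _).trans (mul_le_mul_of_nonneg_right
    (norm_calculus_le hR hR1 ht.le fun r hr => abs_heatSymbol_sub_le ht hr) (norm_nonneg _))

/-- Convergence at a linear rate on the range of `R` extends to all vectors by density and
contractivity. -/
theorem tendsto_heat (hd : DenseRange R) (f : H) :
    Tendsto (fun t => R (calculus R (heatSymbol t) f)) (𝓝[>] 0) (𝓝 f) := by
  rw [Metric.tendsto_nhds]
  intro ε hε
  obtain ⟨h, hh⟩ := hd.exists_dist_lt f (show 0 < ε / 3 by positivity)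
  have hb : 0 < ε / 3 / (‖h‖ + 1) := by positivity
  filter_upwards [Ioo_mem_nhdsGT hb] with t ht
  have e1 : R (calculus R (heatSymbol t) f) - f =
      R (calculus R (heatSymbol t) (f - R h)) + (R (calculus R (heatSymbol t) (R h)) - R h)
        - (f - R h) := by
    simp only [map_sub]; abel
  rw [dist_eq_norm] at hh ⊢
  have h1 := norm_heat_le hR hR1 ht.1 (f - R h)
  have h2 := norm_heat_sub_le hR hR1 ht.1 h
  have h3 : t * ‖h‖ ≤ ε / 3 := by
    have := (lt_div_iff₀ (by positivity)).1 ht.2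
    nlinarith [ht.1, norm_nonneg h]
  rw [e1]
  refine (norm_sub_le _ _).trans_lt ?_
  have h4 := norm_add_le (R (calculus R (heatSymbol t) (f - R h)))
    (R (calculus R (heatSymbol t) (R h)) - R h)
  linarith

/-- The hypothesis `ha` expresses R = (1 - L)⁻¹. Keeping `R` outermost in the orbit places it in
`D`, and its derivative R w - w is then L (R w). -/
theorem exists_isOrbit_of_resolvent {D : Set H} {a : H → H → ℝ} (hd : DenseRange R)
    (hRD : ∀ h, R h ∈ D) (ha : ∀ h, ∀ v ∈ D, a (R h) v = ⟪h, v⟫_ℝ - ⟪R h, v⟫_ℝ) (f : H) :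
    ∃ u, IsOrbit D a f u := by
  classical
  refine ⟨fun t => if 0 < t then R (calculus R (heatSymbol t) f) else f, ?_, by simp, ?_⟩
  · intro t ht
    rcases (show 0 ≤ t from ht).eq_or_lt with rfl | h0
    · rw [← continuousWithinAt_Ioi_iff_Ici, ContinuousWithinAt]
      have := tendsto_heat hR hR1 hd f
      simp only [lt_irrefl, if_false]
      refine this.congr' ?_
      filter_upwards [self_mem_nhdsWithin] with t ht
      rw [if_pos (mem_Ioi.1 ht)]
    · refine ((hasDerivAt_calculus hR hR1 h0 f).continuousAt.congr ?_).continuousWithinAt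
      filter_upwards [lt_mem_nhds h0] with s hs
      rw [if_pos hs]
  · intro t ht
    simp only [if_pos ht]
    refine ⟨hRD _, _, (hasDerivAt_calculus hR hR1 ht f).congr_of_eventuallyEq ?_, ?_⟩
    · filter_upwards [lt_mem_nhds ht] with s hs
      rw [if_pos hs]
    · intro v hv
      rw [ha _ v hv, inner_sub_left]; ring

end Orbit

/-! ### Invariant projections of an abstract closed form -/

section AbstractForm

variable {H : Type*} [NormedAddCommGroup H] [InnerProductSpace ℝ H]
  {D : Set H} {a : H → H → ℝ}

theorem isOrbit_semigroup {f : H} (h : ∃ u, IsOrbit D a f u) :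
    IsOrbit D a f fun t => semigroup D a t f := by
  have : (fun t => semigroup D a t f) = h.choose := by
    funext t; rw [semigroup, dif_pos h]
  rw [this]
  exact h.choose_spec

/-- The derivative of ‖u‖² is -2 a(u, u), which is nonpositive. -/
theorem IsOrbit.norm_le (ha : ∀ v ∈ D, 0 ≤ a v v) {f : H} {u : ℝ → H} (hu : IsOrbit D a f u)
    {t : ℝ} (ht : 0 ≤ t) : ‖u t‖ ≤ ‖f‖ := by
  obtain ⟨hc, h0, h⟩ := hu
  have hd : ∀ s, 0 < s → ∃ z, HasDerivAt (fun s => ‖u s‖ ^ 2) (2 * ⟪u s, z⟫_ℝ) s ∧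
      ⟪u s, z⟫_ℝ ≤ 0 := fun s hs => by
    obtain ⟨hD, z, hz, hza⟩ := h s hs
    refine ⟨z, hz.norm_sq, ?_⟩
    have := hza _ hD
    rw [real_inner_comm]
    linarith [ha _ hD]
  have hanti : AntitoneOn (fun s => ‖u s‖ ^ 2) (Ici 0) := by
    refine antitoneOn_of_deriv_nonpos (convex_Ici 0) (hc.norm.pow 2) ?_ ?_
    · rw [interior_Ici]
      intro s hs
      obtain ⟨z, hz, -⟩ := hd s hs
      exact hz.differentiableAt.differentiableWithinAt
    · rw [interior_Ici]
      intro s hs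
      obtain ⟨z, hz, hz0⟩ := hd s hs
      rw [hz.deriv]; linarith
  have := hanti (mem_Ici.2 le_rfl) (mem_Ici.2 ht) ht
  simp only [h0] at this
  exact (pow_le_pow_iff_left₀ (norm_nonneg _) (norm_nonneg _) two_ne_zero).1 this

/-- The vectors `u t - u' t`, for `u` an orbit of `h` itself, are not all orthogonal to `h`. -/
theorem IsOrbit.eq_zero_of_orthogonal (ha : ∀ v ∈ D, 0 ≤ a v v) {h : H} {u : ℝ → H}
    (hu : IsOrbit D a h u)
    (ho : ∀ t, 0 < t → ∀ z, HasDerivAt u z t → ⟪u t - z, h⟫_ℝ = 0) : h = 0 := by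
  -- Orthogonality makes exp(-t)⟪u t, h⟫ constant. Comparing times 0 and 1 gives ‖h‖² ≤ e⁻¹⟪u 1, h⟫
  -- ≤ e⁻¹‖h‖², so no integral over all times is needed.
  have hm : MonotoneOn (fun t => Real.exp (-t) * ⟪u t, h⟫_ℝ) (Ici 0) := by
    have hd : ∀ t, 0 < t → HasDerivAt (fun t => Real.exp (-t) * ⟪u t, h⟫_ℝ) 0 t := fun t ht => by
      obtain ⟨-, z, hz, -⟩ := hu.2.2 t ht
      have h1 := ho t ht z hz
      rw [inner_sub_left] at h1
      have h2 := (hasDerivAt_neg t).exp.fun_mul (hz.inner ℝ (hasDerivAt_const t h))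
      refine h2.congr_deriv ?_
      rw [inner_zero_right]
      linear_combination -Real.exp (-t) * h1
    refine monotoneOn_of_deriv_nonneg (convex_Ici 0) ?_ ?_ ?_
    · exact (Continuous.continuousOn (by fun_prop)).mul
        (hu.1.inner continuousOn_const)
    · rw [interior_Ici]
      exact fun t ht => (hd t ht).differentiableAt.differentiableWithinAt
    · rw [interior_Ici]
      exact fun t ht => (hd t ht).deriv.ge
  have h1 := hm (mem_Ici.2 le_rfl) (mem_Ici.2 zero_le_one) zero_le_one
  simp only [hu.2.1, neg_zero, Real.exp_zero, one_mul, real_inner_self_eq_norm_sq] at h1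
  have h2 : ⟪u 1, h⟫_ℝ ≤ ‖h‖ ^ 2 := by
    refine (real_inner_le_norm _ _).trans ?_
    rw [sq]
    exact mul_le_mul_of_nonneg_right (hu.norm_le ha zero_le_one) (norm_nonneg _)
  have h3 : Real.exp (-1) < 1 := by rw [Real.exp_lt_one_iff]; norm_num
  have h4 : ‖h‖ ^ 2 ≤ 0 := by
    by_contra! hc
    nlinarith [Real.exp_pos (-1)]
  simpa using h4.antisymm (sq_nonneg _)

variable [CompleteSpace H] {E : Type*} [NormedAddCommGroup E] [InnerProductSpace ℝ E]
  [CompleteSpace E] {J : E →L[ℝ] H}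

open ContinuousLinearMap (adjoint adjoint_inner_left adjoint_inner_right)

/-- The orthogonal complement of the range of J* is the kernel of J. -/
theorem denseRange_adjoint (hJ : Function.Injective J) : DenseRange (adjoint J) := by
  have h : (adjoint J).rangeᗮ = ⊥ := by
    rw [ContinuousLinearMap.orthogonal_range, ContinuousLinearMap.adjoint_adjoint]
    exact LinearMap.ker_eq_bot.2 hJ
  have := (Submodule.topologicalClosure_eq_top_iff (K := (adjoint J).range)).2 h
  rw [← Submodule.dense_iff_topologicalClosure_eq_top] at this
  rwa [LinearMap.coe_range] at this

/-- The operator J J* serves as the resolvent, since ⟪J* h, y⟫ = ⟪h, J y⟫ for every y in E. -/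
theorem exists_isOrbit (hJ : Function.Injective J) (hd : DenseRange J) (hn : ∀ x, ‖J x‖ ≤ ‖x‖)
    (ha : ∀ x y, a (J x) (J y) = ⟪x, y⟫_ℝ - ⟪J x, J y⟫_ℝ) (f : H) :
    ∃ u, IsOrbit (range J) a f u := by
  have hJn : ‖J‖ ≤ 1 := ContinuousLinearMap.opNorm_le_bound _ zero_le_one (by simpa using hn)
  refine exists_isOrbit_of_resolvent (R := J ∘L adjoint J)
    (ContinuousLinearMap.isPositive_self_comp_adjoint J) ?_ ?_ (fun h => mem_range_self (adjoint J h)) ?_ f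
  · refine (ContinuousLinearMap.opNorm_comp_le _ _).trans ?_
    rw [LinearIsometryEquiv.norm_map]
    exact mul_le_one₀ hJn (norm_nonneg _) hJn
  · exact hd.comp (denseRange_adjoint hJ) J.continuous
  · rintro h _ ⟨y, rfl⟩
    change a (J (adjoint J h)) (J y) = ⟪h, J y⟫_ℝ - ⟪J (adjoint J h), J y⟫_ℝ
    rw [ha, adjoint_inner_left]

/-- The resolvent commutes with an operator that commutes with the semigroup. -/
theorem resolvent_comm (hJ : Function.Injective J) (hd : DenseRange J) (hn : ∀ x, ‖J x‖ ≤ ‖x‖)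
    (ha : ∀ x y, a (J x) (J y) = ⟪x, y⟫_ℝ - ⟪J x, J y⟫_ℝ) {P : H →L[ℝ] H}
    (hP : ∀ t, 0 < t → ∀ f, semigroup (range J) a t (P f) = P (semigroup (range J) a t f)) (h : H) :
    P (J (adjoint J h)) = J (adjoint J (P h)) := by
  have hu : ∀ f, IsOrbit (range J) a f fun t => semigroup (range J) a t f := fun f =>
    isOrbit_semigroup (exists_isOrbit hJ hd hn ha f)
  have ha0 : ∀ v ∈ range J, 0 ≤ a v v := by
    rintro _ ⟨x, rfl⟩
    rw [ha, real_inner_self_eq_norm_sq, real_inner_self_eq_norm_sq, sub_nonneg]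
    exact pow_le_pow_left₀ (norm_nonneg _) (hn x) 2
  -- With z = L w this inverts the resolvent: w = (1 - L)⁻¹(w - L w).
  have key : ∀ w z, w ∈ range J → (∀ v ∈ range J, a w v = -⟪z, v⟫_ℝ) →
      w = J (adjoint J (w - z)) := by
    rintro _ z ⟨x, rfl⟩ hx
    congr 1
    refine ext_inner_right ℝ fun y => ?_
    rw [adjoint_inner_left, inner_sub_left]
    have := hx _ ⟨y, rfl⟩
    rw [ha] at this
    linarith
  set T : H →L[ℝ] H := P ∘L J ∘L adjoint J - J ∘L adjoint J ∘L P with hT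
  suffices hT0 : T = 0 by
    have := congrArg (fun S : H →L[ℝ] H => S h) hT0
    simpa [hT, sub_eq_zero] using this
  have hTu : ∀ f t, 0 < t → ∀ z, HasDerivAt (fun t => semigroup (range J) a t f) z t →
      T (semigroup (range J) a t f - z) = 0 := by
    intro f t ht z hz
    obtain ⟨h1, z', hz', h2⟩ := (hu f).2.2 t ht
    obtain ⟨h3, z₂, hz₂, h4⟩ := (hu (P f)).2.2 t ht
    obtain rfl := hz.unique hz'
    have h5 : HasDerivAt (fun t => semigroup (range J) a t (P f)) (P z) t := by
      refine (P.hasFDerivAt.comp_hasDerivAt t hz).congr_of_eventuallyEq ?_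
      filter_upwards [lt_mem_nhds ht] with s hs using hP s hs f
    obtain rfl := hz₂.unique h5
    have h6 := key _ _ h1 h2
    have h7 := key _ _ h3 h4
    simp only [hP t ht] at h7
    rw [hT, sub_apply, ContinuousLinearMap.comp_apply, ContinuousLinearMap.comp_apply,
      ContinuousLinearMap.comp_apply, ContinuousLinearMap.comp_apply, ← h6, map_sub P, ← h7,
      sub_self]
  -- The commutator T kills u - u' along every orbit. Taking the orbit that starts at T* k shows
  -- that T* k is orthogonal to its own u - u', hence zero.
  have hadj : adjoint T = 0 := by
    ext k
    refine (hu (adjoint T k)).eq_zero_of_orthogonal ha0 fun t ht z hz => ?_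
    rw [adjoint_inner_right, hTu _ t ht z hz, inner_zero_left]
  simpa using congrArg adjoint hadj

/-- A projection which commutes with the semigroup acts on the domain of the form, and it is
symmetric for the form. -/
theorem exists_projection (hJ : Function.Injective J) (hd : DenseRange J) (hn : ∀ x, ‖J x‖ ≤ ‖x‖)
    (ha : ∀ x y, a (J x) (J y) = ⟪x, y⟫_ℝ - ⟪J x, J y⟫_ℝ) {P : H →L[ℝ] H}
    (hP : ∀ t, 0 < t → ∀ f, semigroup (range J) a t (P f) = P (semigroup (range J) a t f))
    (hPP : ∀ f, P (P f) = P f) (hPs : ∀ f g, ⟪P f, g⟫_ℝ = ⟪f, P g⟫_ℝ) :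
    ∃ Q : E → E, (∀ x, J (Q x) = P (J x)) ∧ ∀ x y, ⟪Q x, y⟫_ℝ = ⟪x, Q y⟫_ℝ := by
  have hR := resolvent_comm hJ hd hn ha hP
  -- Commutation and P² = P give ‖J* P h‖² = ⟪J* P h, J* h⟫. Thus J* h ↦ J* P h is a contraction on
  -- a dense subspace of E, and `Q` is its extension.
  have hle : ∀ h, ‖adjoint J (P h)‖ ≤ ‖adjoint J h‖ := fun h => by
    have h1 : ‖adjoint J (P h)‖ ^ 2 ≤ ‖adjoint J (P h)‖ * ‖adjoint J h‖ := by
      rw [← real_inner_self_eq_norm_sq]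
      refine le_trans (le_of_eq ?_) (real_inner_le_norm _ _)
      rw [adjoint_inner_left, ← hR, ← hPs, hPP, ← adjoint_inner_left]
    by_contra! hc
    have : 0 < ‖adjoint J (P h)‖ := (norm_nonneg _).trans_lt hc
    nlinarith
  have hex : ∀ x, ∃ y, J y = P (J x) ∧ ‖y‖ ≤ ‖x‖ := fun x => by
    obtain ⟨k, hk, hkx⟩ := mem_closure_iff_seq_limit.1 ((denseRange_adjoint hJ) x)
    choose f hf using hk
    obtain rfl : (fun n => adjoint J (f n)) = k := funext hf
    have hc : CauchySeq fun n => adjoint J (P (f n)) := by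
      rw [Metric.cauchySeq_iff]
      intro ε hε
      obtain ⟨N, hN⟩ := Metric.cauchySeq_iff.1 hkx.cauchySeq ε hε
      refine ⟨N, fun m hm n hn => lt_of_le_of_lt ?_ (hN m hm n hn)⟩
      rw [dist_eq_norm, dist_eq_norm, ← map_sub, ← map_sub, ← map_sub]
      exact hle _
    obtain ⟨y, hy⟩ := cauchySeq_tendsto_of_complete hc
    refine ⟨y, tendsto_nhds_unique ((J.continuous.tendsto y).comp hy) ?_,
      le_of_tendsto_of_tendsto hy.norm hkx.norm (Eventually.of_forall fun n => hle _)⟩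
    refine (((P ∘L J).continuous.tendsto x).comp hkx).congr fun n => ?_
    simp [hR]
  choose Q hQ hQn using hex
  have hQa : ∀ h, Q (adjoint J h) = adjoint J (P h) := fun h => hJ (by rw [hQ, hR])
  have hQs : ∀ x y, Q (x - y) = Q x - Q y := fun x y => hJ (by simp only [hQ, map_sub])
  have hQc : Continuous Q := by
    refine (LipschitzWith.of_dist_le_mul (K := 1) fun x y => ?_).continuous
    rw [dist_eq_norm, dist_eq_norm, ← hQs, NNReal.coe_one, one_mul]
    exact hQn _
  refine ⟨Q, hQ, fun x y => ?_⟩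
  refine congrFun ((denseRange_adjoint hJ).equalizer (g := fun y => ⟪Q x, y⟫_ℝ)
    (h := fun y => ⟪x, Q y⟫_ℝ) (by fun_prop) (by fun_prop) ?_) y
  funext h
  simp only [Function.comp_apply]
  rw [hQa, adjoint_inner_right, adjoint_inner_right, hQ, hPs]

end AbstractForm

/-! ### Test functions and integration by parts -/

section TestFunctions

variable {n : ℕ} {ρ : Sp n → ℝ} {φ ψ : Sp n → ℝ}

/-- The standard basis vector. -/
abbrev stdVec (i : Fin (n + 1)) : Sp n := EuclideanSpace.single i 1

/-- The partial derivative in the direction of a standard basis vector. -/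
def partialDeriv (i : Fin (n + 1)) (φ : Sp n → ℝ) (x : Sp n) : ℝ := fderiv ℝ φ x (stdVec i)

theorem gradient_apply (φ : Sp n → ℝ) (x : Sp n) (i : Fin (n + 1)) :
    gradient φ x i = partialDeriv i φ x := by
  rw [partialDeriv, ← inner_gradient_left, EuclideanSpace.inner_single_right]
  simp

theorem inner_gradient (φ ψ : Sp n → ℝ) (x : Sp n) :
    ⟪gradient φ x, gradient ψ x⟫_ℝ = ∑ i, partialDeriv i φ x * partialDeriv i ψ x := by
  rw [PiLp.inner_apply]
  refine Finset.sum_congr rfl fun i _ => ?_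
  rw [gradient_apply, gradient_apply, RCLike.inner_apply', conj_trivial]

theorem continuous_gradient (hφ : ContDiff ℝ 1 φ) : Continuous (gradient φ) :=
  (LinearIsometryEquiv.continuous _).comp (hφ.continuous_fderiv one_ne_zero)

theorem hasCompactSupport_gradient (hφ : HasCompactSupport φ) : HasCompactSupport (gradient φ) :=
  (hφ.fderiv ℝ).comp_left (map_zero _)

theorem continuous_partialDeriv (i : Fin (n + 1)) (hφ : ContDiff ℝ 1 φ) :
    Continuous (partialDeriv i φ) :=
  (hφ.continuous_fderiv one_ne_zero).clm_apply continuous_const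

theorem hasCompactSupport_partialDeriv (i : Fin (n + 1)) (hφ : HasCompactSupport φ) :
    HasCompactSupport (partialDeriv i φ) :=
  hφ.fderiv_apply ℝ _

theorem contDiff_partialDeriv (i : Fin (n + 1)) (hφ : ContDiff ℝ ∞ φ) :
    ContDiff ℝ ∞ (partialDeriv i φ) :=
  (hφ.fderiv_right (m := ∞) (by simp)).clm_apply contDiff_const

namespace IsTest

theorem contDiff_one (h : IsTest φ) : ContDiff ℝ 1 φ := h.1.of_le (by simp)

theorem add (h : IsTest φ) (h' : IsTest ψ) : IsTest (φ + ψ) := ⟨h.1.add h'.1, h.2.add h'.2⟩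

theorem smul (c : ℝ) (h : IsTest φ) : IsTest (c • φ) := ⟨h.1.const_smul c, h.2.smul_left⟩

theorem sub (h : IsTest φ) (h' : IsTest ψ) : IsTest (φ - ψ) := by
  rw [sub_eq_add_neg, ← neg_one_smul ℝ ψ]; exact h.add (h'.smul _)

theorem zero : IsTest (0 : Sp n → ℝ) := ⟨contDiff_const, HasCompactSupport.zero⟩

theorem memLp (h : IsTest φ) (μ : Measure (Sp n)) [IsFiniteMeasureOnCompacts μ] : MemLp φ 2 μ :=
  h.1.continuous.memLp_of_hasCompactSupport h.2

theorem memLp_gradient (h : IsTest φ) (μ : Measure (Sp n)) [IsFiniteMeasureOnCompacts μ] :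
    MemLp (gradient φ) 2 μ :=
  (continuous_gradient h.contDiff_one).memLp_of_hasCompactSupport (hasCompactSupport_gradient h.2)

theorem gradient_add (h : IsTest φ) (h' : IsTest ψ) :
    gradient (φ + ψ) = gradient φ + gradient ψ := by
  funext x
  simp only [gradient, Pi.add_apply]
  rw [fderiv_add (h.contDiff_one.differentiable one_ne_zero x)
    (h'.contDiff_one.differentiable one_ne_zero x), map_add]

theorem gradient_smul (c : ℝ) (h : IsTest φ) : gradient (c • φ) = c • gradient φ := by
  funext x
  simp only [gradient, Pi.smul_apply]
  rw [fderiv_const_smul (h.contDiff_one.differentiable one_ne_zero x), map_smul]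

theorem gradient_sub (h : IsTest φ) (h' : IsTest ψ) :
    gradient (φ - ψ) = gradient φ - gradient ψ := by
  rw [sub_eq_add_neg, ← neg_one_smul ℝ ψ, h.gradient_add (h'.smul _), h'.gradient_smul,
    neg_one_smul, sub_eq_add_neg]

end IsTest

/-- The weighted Laplacian `div (ρ ∇ψ)`. -/
def divGrad (ρ ψ : Sp n → ℝ) (x : Sp n) : ℝ :=
  ∑ i, partialDeriv i (fun y => ρ y * partialDeriv i ψ y) x

theorem contDiff_mul_partialDeriv (hρ : ContDiff ℝ 1 ρ) (hψ : IsTest ψ) (i : Fin (n + 1)) :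
    ContDiff ℝ 1 fun y => ρ y * partialDeriv i ψ y :=
  hρ.mul ((contDiff_partialDeriv i hψ.1).of_le (by simp))

theorem hasCompactSupport_mul_partialDeriv (hψ : IsTest ψ) (i : Fin (n + 1)) :
    HasCompactSupport fun y => ρ y * partialDeriv i ψ y :=
  (hasCompactSupport_partialDeriv i hψ.2).mul_left

theorem continuous_divGrad (hρ : ContDiff ℝ 1 ρ) (hψ : IsTest ψ) : Continuous (divGrad ρ ψ) :=
  continuous_finsetSum _ fun i _ => continuous_partialDeriv i (contDiff_mul_partialDeriv hρ hψ i)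

theorem hasCompactSupport_divGrad (hψ : IsTest ψ) : HasCompactSupport (divGrad ρ ψ) := by
  have : divGrad ρ ψ = ∑ i, partialDeriv i (fun y => ρ y * partialDeriv i ψ y) := by
    funext x; simp [divGrad]
  rw [this]
  exact HasCompactSupport.finset_sum fun i _ =>
    hasCompactSupport_partialDeriv i (hasCompactSupport_mul_partialDeriv hψ i)

/-- Integration by parts. -/
theorem integral_inner_gradient (hρ : ContDiff ℝ 1 ρ) (hφ : IsTest φ) (hψ : IsTest ψ) :
    ∫ x, ⟪gradient φ x, gradient ψ x⟫_ℝ * ρ x = -∫ x, φ x * divGrad ρ ψ x := by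
  have hc := contDiff_mul_partialDeriv hρ hψ
  have hk : ∀ i, HasCompactSupport fun y => ρ y * partialDeriv i ψ y :=
    hasCompactSupport_mul_partialDeriv hψ
  have h1 : ∀ i, Integrable fun x => partialDeriv i φ x * (ρ x * partialDeriv i ψ x) := fun i =>
    ((continuous_partialDeriv i hφ.contDiff_one).mul (hc i).continuous).integrable_of_hasCompactSupport
      (hk i).mul_left
  have h2 : ∀ i, Integrable fun x =>
      φ x * partialDeriv i (fun y => ρ y * partialDeriv i ψ y) x := fun i =>
    (hφ.1.continuous.mul (continuous_partialDeriv i (hc i))).integrable_of_hasCompactSupport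
      hφ.2.mul_right
  simp only [inner_gradient, divGrad, Finset.mul_sum, Finset.sum_mul]
  rw [integral_finsetSum _ fun i _ => h2 i, ← Finset.sum_neg_distrib]
  have e : ∀ i x, partialDeriv i φ x * partialDeriv i ψ x * ρ x =
      partialDeriv i φ x * (ρ x * partialDeriv i ψ x) := fun i x => by ring
  simp only [e]
  rw [integral_finsetSum _ fun i _ => h1 i]
  refine Finset.sum_congr rfl fun i _ => ?_
  rw [eq_neg_iff_add_eq_zero, add_comm, ← eq_neg_iff_add_eq_zero]
  exact integral_mul_fderiv_eq_neg_fderiv_mul_of_integrable (h1 i) (h2 i)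
    ((hφ.1.continuous.mul (hc i).continuous).integrable_of_hasCompactSupport hφ.2.mul_right)
    (fun x _ => hφ.contDiff_one.differentiable one_ne_zero x)
    (fun x _ => (hc i).differentiable one_ne_zero x)

end TestFunctions

/-! ### The energy space -/

section EnergySpace

variable {n : ℕ} {ρ : Sp n → ℝ} {S : Measure (Sp n)}

/-- The measure `ϱ λ^d`. -/
def volWeighted (ρ : Sp n → ℝ) : Measure (Sp n) :=
  (volume : Measure (Sp n)).withDensity fun x => ENNReal.ofReal (ρ x)

theorem volWeighted_le (ρ : Sp n → ℝ) (S : Measure (Sp n)) : volWeighted ρ ≤ weighted ρ S :=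
  (Measure.le_add_right le_rfl).trans_eq (withDensity_add_measure _ _ _).symm

theorem isFiniteMeasure_weighted (hρ_int : Integrable ρ (volume + S)) :
    IsFiniteMeasure (weighted ρ S) := by
  refine ⟨?_⟩
  rw [weighted, withDensity_apply _ MeasurableSet.univ, Measure.restrict_univ]
  exact hρ_int.lintegral_lt_top

theorem isFiniteMeasure_volWeighted [IsFiniteMeasure (weighted ρ S)] :
    IsFiniteMeasure (volWeighted ρ) := isFiniteMeasure_of_le _ (volWeighted_le ρ S)

theorem integral_volWeighted (hρ : ContDiff ℝ 1 ρ) (hρ_pos : ∀ x, 0 < ρ x) (g : Sp n → ℝ) :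
    ∫ x, g x ∂volWeighted ρ = ∫ x, g x * ρ x := by
  rw [volWeighted, integral_withDensity_eq_integral_toReal_smul
    hρ.continuous.measurable.ennreal_ofReal (by simp)]
  refine integral_congr_ae (.of_forall fun x => ?_)
  simp [ENNReal.toReal_ofReal (hρ_pos x).le, mul_comm]

theorem volume_absolutelyContinuous_volWeighted (hρ : ContDiff ℝ 1 ρ) (hρ_pos : ∀ x, 0 < ρ x) :
    (volume : Measure (Sp n)) ≪ volWeighted ρ :=
  withDensity_absolutelyContinuous' hρ.continuous.measurable.ennreal_ofReal.aemeasurable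
    (.of_forall fun x => by simpa using hρ_pos x)

/-- The restriction of functions to a smaller measure. -/
def restrictLp {X : Type*} [MeasurableSpace X] {μ ν : Measure X} (h : ν ≤ μ) :
    Lp ℝ 2 μ →L[ℝ] Lp ℝ 2 ν :=
  LinearMap.mkContinuous
    { toFun := fun f => ((Lp.memLp f).mono_measure h).toLp f
      map_add' := fun f g => by
        rw [← MemLp.toLp_add]
        exact MemLp.toLp_congr _ _ (ae_mono h (Lp.coeFn_add f g))
      map_smul' := fun c f => by
        rw [RingHom.id_apply, ← MemLp.toLp_const_smul]
        exact MemLp.toLp_congr _ _ (ae_mono h (Lp.coeFn_smul c f)) } 1 fun f => by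
    rw [one_mul, Lp.norm_def f]
    refine (Lp.norm_toLp (f : X → ℝ) ((Lp.memLp f).mono_measure h)).trans_le ?_
    exact ENNReal.toReal_mono (Lp.eLpNorm_ne_top f) (eLpNorm_mono_measure _ h)

theorem coeFn_restrictLp {X : Type*} [MeasurableSpace X] {μ ν : Measure X} (h : ν ≤ μ)
    (f : Lp ℝ 2 μ) : restrictLp h f =ᵐ[ν] f :=
  MemLp.coeFn_toLp ((Lp.memLp f).mono_measure h)

/-- The space of pairs `(f, F)`, where `F` stands for the gradient of `f`. -/
abbrev PairSpace (ρ : Sp n → ℝ) (S : Measure (Sp n)) : Type :=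
  WithLp 2 (Lp ℝ 2 (weighted ρ S) × Lp (Sp n) 2 (volWeighted ρ))

/-- The test functions together with their gradients. -/
def testGraph (ρ : Sp n → ℝ) (S : Measure (Sp n)) : Submodule ℝ (PairSpace ρ S) where
  carrier := {p | ∃ φ, IsTest φ ∧ p.fst =ᵐ[weighted ρ S] φ ∧ p.snd =ᵐ[volWeighted ρ] gradient φ}
  zero_mem' := ⟨0, IsTest.zero, Lp.coeFn_zero _ _ _, by
    have : gradient (0 : Sp n → ℝ) = 0 := by funext x; exact gradient_const x 0
    rw [this]; exact Lp.coeFn_zero _ _ _⟩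
  add_mem' := by
    rintro p q ⟨φ, hφ, h1, h2⟩ ⟨ψ, hψ, h3, h4⟩
    refine ⟨φ + ψ, hφ.add hψ, (Lp.coeFn_add _ _).trans (h1.add h3), ?_⟩
    rw [hφ.gradient_add hψ]
    exact (Lp.coeFn_add _ _).trans (h2.add h4)
  smul_mem' := by
    rintro c p ⟨φ, hφ, h1, h2⟩
    refine ⟨c • φ, hφ.smul c, (Lp.coeFn_smul _ _).trans (h1.const_smul c), ?_⟩
    rw [hφ.gradient_smul]
    exact (Lp.coeFn_smul _ _).trans (h2.const_smul c)

/-- The closure of the test functions in the graph norm. -/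
abbrev EnergySpace (ρ : Sp n → ℝ) (S : Measure (Sp n)) : Type :=
  (testGraph ρ S).topologicalClosure

/-- The function of an element of the energy space. -/
def toFn (ρ : Sp n → ℝ) (S : Measure (Sp n)) : EnergySpace ρ S →L[ℝ] Lp ℝ 2 (weighted ρ S) :=
  (WithLp.fstL 2 ℝ _ _).comp (testGraph ρ S).topologicalClosure.subtypeL

/-- The gradient of an element of the energy space. -/
def toGrad (ρ : Sp n → ℝ) (S : Measure (Sp n)) : EnergySpace ρ S →L[ℝ] Lp (Sp n) 2 (volWeighted ρ) :=
  (WithLp.sndL 2 ℝ _ _).comp (testGraph ρ S).topologicalClosure.subtypeL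

theorem inner_energySpace (x y : EnergySpace ρ S) :
    ⟪x, y⟫_ℝ = ⟪toFn ρ S x, toFn ρ S y⟫_ℝ + ⟪toGrad ρ S x, toGrad ρ S y⟫_ℝ := rfl

theorem norm_toFn_le (x : EnergySpace ρ S) : ‖toFn ρ S x‖ ≤ ‖x‖ := by
  rw [← pow_le_pow_iff_left₀ (norm_nonneg _) (norm_nonneg _) two_ne_zero,
    ← real_inner_self_eq_norm_sq, ← real_inner_self_eq_norm_sq, inner_energySpace]
  linarith [real_inner_self_nonneg (x := toGrad ρ S x)]

variable [IsFiniteMeasure (weighted ρ S)]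

/-- A test function as an element of the energy space. -/
def ofTest (ρ : Sp n → ℝ) (S : Measure (Sp n)) [IsFiniteMeasure (weighted ρ S)] {φ : Sp n → ℝ}
    (hφ : IsTest φ) : EnergySpace ρ S :=
  haveI := isFiniteMeasure_volWeighted (ρ := ρ) (S := S)
  ⟨WithLp.toLp 2 ((hφ.memLp _).toLp φ, (hφ.memLp_gradient _).toLp (gradient φ)),
    Submodule.le_topologicalClosure _ ⟨φ, hφ, (hφ.memLp _).coeFn_toLp, (hφ.memLp_gradient _).coeFn_toLp⟩⟩

theorem toFn_ofTest {φ : Sp n → ℝ} (hφ : IsTest φ) :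
    toFn ρ S (ofTest ρ S hφ) =ᵐ[weighted ρ S] φ := (hφ.memLp _).coeFn_toLp

theorem toGrad_ofTest {φ : Sp n → ℝ} (hφ : IsTest φ) :
    toGrad ρ S (ofTest ρ S hφ) =ᵐ[volWeighted ρ] gradient φ :=
  haveI := isFiniteMeasure_volWeighted (ρ := ρ) (S := S)
  (hφ.memLp_gradient _).coeFn_toLp

theorem ofTest_sub {φ ψ : Sp n → ℝ} (hφ : IsTest φ) (hψ : IsTest ψ) :
    ofTest ρ S (hφ.sub hψ) = ofTest ρ S hφ - ofTest ρ S hψ := by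
  apply Subtype.ext
  apply WithLp.ofLp_injective 2
  refine Prod.ext (Lp.ext ?_) (Lp.ext ?_)
  · exact (toFn_ofTest (S := S) (hφ.sub hψ)).trans
      (((toFn_ofTest (S := S) hφ).sub (toFn_ofTest (S := S) hψ)).symm.trans (Lp.coeFn_sub _ _).symm)
  · refine (toGrad_ofTest (S := S) (hφ.sub hψ)).trans ?_
    rw [hφ.gradient_sub hψ]
    exact ((toGrad_ofTest (S := S) hφ).sub (toGrad_ofTest (S := S) hψ)).symm.trans (Lp.coeFn_sub _ _).symm

theorem denseRange_ofTest : Dense {x : EnergySpace ρ S | ∃ φ, ∃ hφ : IsTest φ, x = ofTest ρ S hφ} := by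
  intro x
  rw [Topology.IsInducing.subtypeVal.closure_eq_preimage_closure_image]
  refine closure_mono ?_ x.2
  rintro p ⟨φ, hφ, h1, h2⟩
  refine ⟨ofTest ρ S hφ, ⟨φ, hφ, rfl⟩, ?_⟩
  apply WithLp.ofLp_injective 2
  exact Prod.ext (Lp.ext ((toFn_ofTest (S := S) hφ).trans h1.symm))
    (Lp.ext ((toGrad_ofTest (S := S) hφ).trans h2.symm))

theorem denseRange_toFn : DenseRange (toFn ρ S) := by
  refine (Lp.dense_hasCompactSupport_contDiff (μ := weighted ρ S) (F := ℝ)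
    (p := 2) (by simp)).mono ?_
  rintro f ⟨φ, h1, h2, h3⟩
  exact ⟨ofTest ρ S ⟨h3, h2⟩, Lp.ext ((toFn_ofTest (S := S) _).trans h1.symm)⟩

theorem inner_toGrad_ofTest_ofTest (hρ : ContDiff ℝ 1 ρ) (hρ_pos : ∀ x, 0 < ρ x)
    {φ ψ : Sp n → ℝ} (hφ : IsTest φ) (hψ : IsTest ψ) :
    ⟪toGrad ρ S (ofTest ρ S hφ), toGrad ρ S (ofTest ρ S hψ)⟫_ℝ = preForm ρ φ ψ := by
  rw [L2.inner_def, preForm, ← integral_volWeighted hρ hρ_pos]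
  refine integral_congr_ae ?_
  filter_upwards [toGrad_ofTest (ρ := ρ) (S := S) hφ, toGrad_ofTest (ρ := ρ) (S := S) hψ]
    with x h1 h2
  rw [h1, h2]

/-- The gradient of an element of the energy space is a weak gradient. -/
theorem inner_toGrad_ofTest (hρ : ContDiff ℝ 1 ρ) (hρ_pos : ∀ x, 0 < ρ x) (x : EnergySpace ρ S)
    {ψ : Sp n → ℝ} (hψ : IsTest ψ) :
    ⟪toGrad ρ S x, toGrad ρ S (ofTest ρ S hψ)⟫_ℝ = -∫ y, toFn ρ S x y * divGrad ρ ψ y := by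
  have := isFiniteMeasure_volWeighted (ρ := ρ) (S := S)
  -- Dividing by ϱ turns the Lebesgue pairing into an inner product in L²(ϱλ^d). Both sides are then
  -- continuous in `x`, and the identity extends from test functions by density.
  have hw : MemLp (fun y => divGrad ρ ψ y / ρ y) 2 (volWeighted ρ) := by
    refine Continuous.memLp_of_hasCompactSupport ?_ ?_
    · exact (continuous_divGrad hρ hψ).div hρ.continuous fun y => (hρ_pos y).ne'
    · exact (hasCompactSupport_divGrad hψ).mul_right
  have hint : ∀ x, ∫ y, toFn ρ S x y * divGrad ρ ψ y =
      ⟪restrictLp (volWeighted_le ρ S) (toFn ρ S x), hw.toLp _⟫_ℝ := fun x => by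
    rw [L2.inner_def]
    have : ∀ y, toFn ρ S x y * divGrad ρ ψ y =
        toFn ρ S x y * (divGrad ρ ψ y / ρ y) * ρ y := fun y => by
      have := (hρ_pos y).ne'
      field_simp
    simp only [this]
    rw [← integral_volWeighted hρ hρ_pos]
    refine integral_congr_ae ?_
    filter_upwards [coeFn_restrictLp (volWeighted_le ρ S) (toFn ρ S x), hw.coeFn_toLp]
      with y h1 h2
    rw [h1, h2, RCLike.inner_apply', conj_trivial]
  rw [hint]
  revert x
  refine fun x => congrFun (Continuous.ext_on denseRange_ofTest
    (f := fun x => ⟪toGrad ρ S x, toGrad ρ S (ofTest ρ S hψ)⟫_ℝ)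
    (g := fun x => -⟪restrictLp (volWeighted_le ρ S) (toFn ρ S x), hw.toLp _⟫_ℝ)
    (by fun_prop) (by fun_prop) ?_) x
  rintro _ ⟨φ, hφ, rfl⟩
  simp only
  rw [inner_toGrad_ofTest_ofTest hρ hρ_pos, ← hint, preForm, integral_inner_gradient hρ hφ hψ]
  congr 1
  refine integral_congr_ae ?_
  filter_upwards [(volume_absolutelyContinuous_volWeighted hρ hρ_pos).ae_le
    (ae_mono (volWeighted_le ρ S) (toFn_ofTest hφ))] with y hy
  rw [hy]

/-- If an element of the energy space vanishes Lebesgue almost everywhere, its gradient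
vanishes. -/
theorem toGrad_eq_zero (hρ : ContDiff ℝ 1 ρ) (hρ_pos : ∀ x, 0 < ρ x) {x : EnergySpace ρ S}
    (hx : toFn ρ S x =ᵐ[volume] 0) : toGrad ρ S x = 0 := by
  have h : ∀ y, ⟪toGrad ρ S x, toGrad ρ S y⟫_ℝ = 0 := fun y =>
    congrFun (Continuous.ext_on denseRange_ofTest
      (f := fun y => ⟪toGrad ρ S x, toGrad ρ S y⟫_ℝ) (g := fun y => 0)
      (by fun_prop) (by fun_prop) (by
        rintro _ ⟨φ, hφ, rfl⟩
        simp only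
        rw [inner_toGrad_ofTest hρ hρ_pos, integral_eq_zero_of_ae, neg_zero]
        filter_upwards [hx] with y hy
        rw [hy]; simp)) y
  exact inner_self_eq_zero.1 (h x)

/-- Closability of the form: a function that is zero ϱμ-a.e. is zero Lebesgue-a.e., and its gradient
sees only Lebesgue measure. -/
theorem injective_toFn (hρ : ContDiff ℝ 1 ρ) (hρ_pos : ∀ x, 0 < ρ x) :
    Function.Injective (toFn ρ S) := by
  rw [injective_iff_map_eq_zero]
  intro x hx
  have h1 : toGrad ρ S x = 0 := by
    refine toGrad_eq_zero hρ hρ_pos ?_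
    rw [hx]
    exact (volume_absolutelyContinuous_volWeighted hρ hρ_pos).ae_le
      (ae_mono (volWeighted_le ρ S) (Lp.coeFn_zero _ _ _))
  rw [← inner_self_eq_zero (𝕜 := ℝ), inner_energySpace, hx, h1]
  simp

end EnergySpace

/-! ### Identification of the closed form with the energy space -/

section FormIdentification

variable {n : ℕ} {ρ : Sp n → ℝ} {S : Measure (Sp n)} [IsFiniteMeasure (weighted ρ S)]

theorem preForm_sub (hρ : ContDiff ℝ 1 ρ) (hρ_pos : ∀ x, 0 < ρ x) {φ ψ : Sp n → ℝ}
    (hφ : IsTest φ) (hψ : IsTest ψ) : preForm ρ (φ - ψ) (φ - ψ) =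
      ‖toGrad ρ S (ofTest ρ S hφ) - toGrad ρ S (ofTest ρ S hψ)‖ ^ 2 := by
  rw [← inner_toGrad_ofTest_ofTest (S := S) hρ hρ_pos (hφ.sub hψ) (hφ.sub hψ), ofTest_sub,
    map_sub, real_inner_self_eq_norm_sq]

theorem tendsto_energySpace {ι : Type*} {l : Filter ι} {u : ι → EnergySpace ρ S}
    {x : EnergySpace ρ S} : Tendsto u l (𝓝 x) ↔
      Tendsto (fun k => toFn ρ S (u k)) l (𝓝 (toFn ρ S x)) ∧
      Tendsto (fun k => toGrad ρ S (u k)) l (𝓝 (toGrad ρ S x)) := by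
  refine ⟨fun h => ⟨((toFn ρ S).continuous.tendsto x).comp h,
    ((toGrad ρ S).continuous.tendsto x).comp h⟩, fun h => ?_⟩
  rw [tendsto_subtype_rng]
  exact ((WithLp.prod_continuous_toLp 2 _ _).tendsto (_, _)).comp (h.1.prodMk_nhds h.2)

theorem tendsto_toFn_ofTest {φ : ℕ → Sp n → ℝ} (hφ : ∀ k, IsTest (φ k))
    (f : Lp ℝ 2 (weighted ρ S)) :
    Tendsto (fun k => toFn ρ S (ofTest ρ S (hφ k))) atTop (𝓝 f) ↔
      Tendsto (fun k => eLpNorm (φ k - ⇑f) 2 (weighted ρ S)) atTop (𝓝 0) := by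
  rw [Lp.tendsto_Lp_iff_tendsto_eLpNorm']
  refine tendsto_congr fun k => eLpNorm_congr_ae ?_
  exact (toFn_ofTest (hφ k)).sub (ae_eq_refl _)

/-- The form-Cauchy condition is the Cauchy condition on gradients, so completeness supplies a limit
in the closed graph. -/
theorem isApprox_iff (hρ : ContDiff ℝ 1 ρ) (hρ_pos : ∀ x, 0 < ρ x)
    {f : Lp ℝ 2 (weighted ρ S)} {φ : ℕ → Sp n → ℝ} (hφ : ∀ k, IsTest (φ k)) :
    IsApprox ρ S f φ ↔
      ∃ x, toFn ρ S x = f ∧ Tendsto (fun k => ofTest ρ S (hφ k)) atTop (𝓝 x) := by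
  constructor
  · rintro ⟨-, h2, h3⟩
    have hc : CauchySeq fun k => toGrad ρ S (ofTest ρ S (hφ k)) := by
      rw [Metric.cauchySeq_iff]
      intro ε hε
      obtain ⟨N, hN⟩ := h2 (ε ^ 2) (by positivity)
      refine ⟨N, fun j hj k hk => ?_⟩
      have := hN j hj k hk
      rw [preForm_sub (S := S) hρ hρ_pos (hφ j) (hφ k)] at this
      rw [dist_eq_norm]
      exact (pow_lt_pow_iff_left₀ (norm_nonneg _) hε.le two_ne_zero).1 this
    obtain ⟨G, hG⟩ := cauchySeq_tendsto_of_complete hc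
    have hf := (tendsto_toFn_ofTest hφ f).2 h3
    have hp : Tendsto (fun k => (ofTest ρ S (hφ k) : PairSpace ρ S)) atTop
        (𝓝 (WithLp.toLp 2 (f, G))) :=
      ((WithLp.prod_continuous_toLp 2 _ _).tendsto (f, G)).comp (hf.prodMk_nhds hG)
    have hmem : WithLp.toLp 2 (f, G) ∈ (testGraph ρ S).topologicalClosure :=
      (Submodule.isClosed_topologicalClosure _).mem_of_tendsto hp
        (.of_forall fun k => (ofTest ρ S (hφ k)).2)
    exact ⟨⟨_, hmem⟩, rfl, tendsto_subtype_rng.2 hp⟩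
  · rintro ⟨x, rfl, hx⟩
    obtain ⟨h1, h2⟩ := tendsto_energySpace.1 hx
    refine ⟨hφ, fun ε hε => ?_, (tendsto_toFn_ofTest hφ _).1 h1⟩
    obtain ⟨N, hN⟩ := Metric.cauchySeq_iff.1 h2.cauchySeq (Real.sqrt ε) (Real.sqrt_pos.2 hε)
    refine ⟨N, fun j hj k hk => ?_⟩
    have := hN j hj k hk
    rw [dist_eq_norm] at this
    rw [preForm_sub (S := S) hρ hρ_pos (hφ j) (hφ k)]
    exact (Real.lt_sqrt (norm_nonneg _)).1 this

theorem exists_isApprox (hρ : ContDiff ℝ 1 ρ) (hρ_pos : ∀ x, 0 < ρ x) (x : EnergySpace ρ S) :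
    ∃ φ, IsApprox ρ S (toFn ρ S x) φ := by
  obtain ⟨u, hu, hux⟩ := mem_closure_iff_seq_limit.1 (denseRange_ofTest x)
  choose φ hφ hφu using hu
  obtain rfl : u = fun k => ofTest ρ S (hφ k) := funext hφu
  exact ⟨φ, (isApprox_iff hρ hρ_pos hφ).2 ⟨x, rfl, hux⟩⟩

theorem formDomain_eq_range (hρ : ContDiff ℝ 1 ρ) (hρ_pos : ∀ x, 0 < ρ x) :
    formDomain ρ S = range (toFn ρ S) := by
  ext f
  constructor
  · rintro ⟨φ, h⟩
    obtain ⟨x, hx, -⟩ := (isApprox_iff hρ hρ_pos h.1).1 h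
    exact ⟨x, hx⟩
  · rintro ⟨x, rfl⟩
    exact exists_isApprox hρ hρ_pos x

/-- Any approximating sequences converge in the energy space, and injectivity fixes their limits;
the sequences chosen in `form` are therefore immaterial. -/
theorem form_toFn (hρ : ContDiff ℝ 1 ρ) (hρ_pos : ∀ x, 0 < ρ x) (x y : EnergySpace ρ S) :
    form ρ S (toFn ρ S x) (toFn ρ S y) = ⟪x, y⟫_ℝ - ⟪toFn ρ S x, toFn ρ S y⟫_ℝ := by
  have h : (∃ φ, IsApprox ρ S (toFn ρ S x) φ) ∧ (∃ ψ, IsApprox ρ S (toFn ρ S y) ψ) :=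
    ⟨exists_isApprox hρ hρ_pos x, exists_isApprox hρ hρ_pos y⟩
  rw [form, dif_pos h, inner_energySpace, add_sub_cancel_left]
  have h1 := h.1.choose_spec
  have h2 := h.2.choose_spec
  obtain ⟨x', hx', hx⟩ := (isApprox_iff hρ hρ_pos h1.1).1 h1
  obtain ⟨y', hy', hy⟩ := (isApprox_iff hρ hρ_pos h2.1).1 h2
  obtain rfl := injective_toFn hρ hρ_pos hx'
  obtain rfl := injective_toFn hρ hρ_pos hy'
  refine Tendsto.limUnder_eq ?_
  refine ((tendsto_energySpace.1 hx).2.inner (tendsto_energySpace.1 hy).2).congr fun k => ?_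
  exact inner_toGrad_ofTest_ofTest hρ hρ_pos _ _

end FormIdentification

/-! ### Multiplication by an indicator -/

section Cutoff

variable {X : Type*} [MeasurableSpace X] {m : Measure X} {B : Set X} (hB : MeasurableSet B)

theorem coeFn_cutoff (f : Lp ℝ 2 m) : ⇑(cutoff hB f) =ᵐ[m] B.indicator ⇑f := by
  unfold cutoff
  exact MemLp.coeFn_toLp _

/-- Multiplication by `1_B` as an operator. -/
def cutoffL : Lp ℝ 2 m →L[ℝ] Lp ℝ 2 m :=
  LinearMap.mkContinuous
    { toFun := cutoff hB
      map_add' := fun f g => Lp.ext <| by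
        filter_upwards [coeFn_cutoff hB (f + g), coeFn_cutoff hB f, coeFn_cutoff hB g,
          Lp.coeFn_add f g, Lp.coeFn_add (cutoff hB f) (cutoff hB g)] with x h1 h2 h3 h4 h5
        rw [h1, h5, Pi.add_apply, h2, h3]
        by_cases hx : x ∈ B
        · simp only [indicator_of_mem hx, h4, Pi.add_apply]
        · simp only [indicator_of_notMem hx, add_zero]
      map_smul' := fun c f => Lp.ext <| by
        filter_upwards [coeFn_cutoff hB (c • f), coeFn_cutoff hB f,
          Lp.coeFn_smul c f, Lp.coeFn_smul c (cutoff hB f)] with x h1 h2 h3 h4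
        rw [h1, RingHom.id_apply, h4, Pi.smul_apply, h2]
        by_cases hx : x ∈ B
        · simp only [indicator_of_mem hx, h3, Pi.smul_apply]
        · simp only [indicator_of_notMem hx, smul_zero] } 1 fun f => by
    rw [one_mul]
    refine Lp.norm_le_norm_of_ae_le ?_
    filter_upwards [coeFn_cutoff hB f] with x h1
    refine (congrArg norm h1).trans_le ?_
    exact norm_indicator_le_norm_self _ _

theorem cutoffL_apply (f : Lp ℝ 2 m) : cutoffL hB f = cutoff hB f := rfl

theorem cutoff_cutoff (f : Lp ℝ 2 m) : cutoff hB (cutoff hB f) = cutoff hB f := Lp.ext <| by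
  filter_upwards [coeFn_cutoff hB (cutoff hB f), coeFn_cutoff hB f] with x h1 h2
  by_cases hx : x ∈ B <;> simp [*]

theorem inner_cutoff (f g : Lp ℝ 2 m) : ⟪cutoff hB f, g⟫_ℝ = ⟪f, cutoff hB g⟫_ℝ := by
  rw [L2.inner_def, L2.inner_def]
  refine integral_congr_ae ?_
  filter_upwards [coeFn_cutoff hB f, coeFn_cutoff hB g] with x h1 h2
  by_cases hx : x ∈ B <;> simp [*]

end Cutoff

/-! ### The action of invariant sets on the energy space -/

section Invariant

variable {n : ℕ} {ρ : Sp n → ℝ} {S : Measure (Sp n)} [IsFiniteMeasure (weighted ρ S)]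

/-- An invariant set acts on the energy space by multiplication with its indicator. -/
theorem exists_cutoff_energySpace (hρ : ContDiff ℝ 1 ρ) (hρ_pos : ∀ x, 0 < ρ x) {B : Set (Sp n)}
    {hB : MeasurableSet B} (hinv : IsInvariant (formDomain ρ S) (form ρ S) hB) :
    ∃ Q : EnergySpace ρ S → EnergySpace ρ S, (∀ x, toFn ρ S (Q x) = cutoff hB (toFn ρ S x)) ∧
      ∀ x y, ⟪toGrad ρ S (Q x), toGrad ρ S y⟫_ℝ = ⟪toGrad ρ S x, toGrad ρ S (Q y)⟫_ℝ := by
  rw [formDomain_eq_range hρ hρ_pos] at hinv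
  obtain ⟨Q, hQ, hQs⟩ := exists_projection (P := cutoffL hB) (a := form ρ S)
    (injective_toFn hρ hρ_pos) denseRange_toFn norm_toFn_le (form_toFn hρ hρ_pos) hinv
    (cutoff_cutoff hB) (inner_cutoff hB)
  refine ⟨Q, hQ, fun x y => ?_⟩
  have := hQs x y
  rw [inner_energySpace, inner_energySpace, hQ, hQ, cutoffL_apply, cutoffL_apply,
    inner_cutoff] at this
  exact add_left_cancel this

end Invariant

/-! ### Rules for partial derivatives -/

section PartialDeriv

variable {n : ℕ} {f g : Sp n → ℝ} {x : Sp n} (i : Fin (n + 1))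

theorem partialDeriv_mul (hf : DifferentiableAt ℝ f x) (hg : DifferentiableAt ℝ g x) :
    partialDeriv i (fun y => f y * g y) x = f x * partialDeriv i g x + partialDeriv i f x * g x := by
  rw [partialDeriv, fderiv_fun_mul hf hg]
  simp [partialDeriv, mul_comm]

theorem partialDeriv_add (hf : DifferentiableAt ℝ f x) (hg : DifferentiableAt ℝ g x) :
    partialDeriv i (fun y => f y + g y) x = partialDeriv i f x + partialDeriv i g x := by
  rw [partialDeriv, fderiv_fun_add hf hg]
  rfl

theorem partialDeriv_sub (hf : DifferentiableAt ℝ f x) (hg : DifferentiableAt ℝ g x) :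
    partialDeriv i (fun y => f y - g y) x = partialDeriv i f x - partialDeriv i g x := by
  rw [partialDeriv, fderiv_fun_sub hf hg]
  rfl

theorem partialDeriv_const_mul (c : ℝ) (hf : DifferentiableAt ℝ f x) :
    partialDeriv i (fun y => c * f y) x = c * partialDeriv i f x := by
  rw [partialDeriv, fderiv_const_mul hf]
  rfl

theorem partialDeriv_coord (j : Fin (n + 1)) :
    partialDeriv i (fun y : Sp n => y j) x = if j = i then 1 else 0 := by
  have : (fun y : Sp n => y j) = EuclideanSpace.proj (𝕜 := ℝ) j := rfl
  rw [partialDeriv, this, ContinuousLinearMap.fderiv]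
  simp [stdVec]

end PartialDeriv

/-! ### Invariant sets are Lebesgue null or conull -/

section Constancy

variable {n : ℕ} {ρ : Sp n → ℝ} {S : Measure (Sp n)} {B : Set (Sp n)}

theorem isTest_coord_mul {φ : Sp n → ℝ} (hφ : IsTest φ) (j : Fin (n + 1)) :
    IsTest fun y => y j * φ y :=
  ⟨(EuclideanSpace.proj (𝕜 := ℝ) j : Sp n →L[ℝ] ℝ).contDiff.mul hφ.1, hφ.2.mul_left⟩

/-- Multiplying by a coordinate changes div(ϱ∇φ) only by first-order terms, since ∇x_j is constant.
After subtraction, 2ϱφ ∂_jφ + φ² ∂_jϱ is left, an exact derivative. -/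
theorem divGrad_coord_mul (hρ : ContDiff ℝ 1 ρ) {φ : Sp n → ℝ} (hφ : IsTest φ) (j : Fin (n + 1))
    (x : Sp n) : φ x * divGrad ρ (fun y => y j * φ y) x - x j * φ x * divGrad ρ φ x =
      partialDeriv j (fun y => ρ y * (φ y * φ y)) x := by
  have hdρ : Differentiable ℝ ρ := hρ.differentiable one_ne_zero
  have hdφ : Differentiable ℝ φ := hφ.contDiff_one.differentiable one_ne_zero
  have hdc : Differentiable ℝ fun y : Sp n => y j :=
    (EuclideanSpace.proj (𝕜 := ℝ) j : Sp n →L[ℝ] ℝ).differentiable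
  have hdp : ∀ i, Differentiable ℝ fun y => ρ y * partialDeriv i φ y := fun i =>
    (contDiff_mul_partialDeriv hρ hφ i).differentiable one_ne_zero
  have e1 : ∀ i, (fun y => ρ y * partialDeriv i (fun y => y j * φ y) y) =
      fun y => y j * (ρ y * partialDeriv i φ y) + (if j = i then 1 else 0) * (ρ y * φ y) := by
    intro i
    funext y
    rw [partialDeriv_mul i (hdc y) (hdφ y), partialDeriv_coord]
    ring
  have e2 : ∀ i, partialDeriv i (fun y => ρ y * partialDeriv i (fun y => y j * φ y) y) x =
      x j * partialDeriv i (fun y => ρ y * partialDeriv i φ y) x +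
        (if j = i then ρ x * partialDeriv i φ x +
          (ρ x * partialDeriv i φ x + partialDeriv i ρ x * φ x) else 0) := by
    intro i
    rw [e1, partialDeriv_add i ((hdc.fun_mul (hdp i)) x) ((hdρ.fun_mul hdφ x).const_mul _),
      partialDeriv_mul i (hdc x) (hdp i x), partialDeriv_coord,
      partialDeriv_const_mul i _ ((hdρ.fun_mul hdφ) x), partialDeriv_mul i (hdρ x) (hdφ x)]
    split_ifs <;> ring
  have e3 : divGrad ρ (fun y => y j * φ y) x = x j * divGrad ρ φ x +
      (ρ x * partialDeriv j φ x + (ρ x * partialDeriv j φ x + partialDeriv j ρ x * φ x)) := by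
    simp only [divGrad, e2, Finset.sum_add_distrib, ← Finset.mul_sum, Finset.sum_ite_eq,
      Finset.mem_univ, if_true]
  rw [e3, partialDeriv_mul j (hdρ x) ((hdφ.fun_mul hdφ) x), partialDeriv_mul j (hdφ x) (hdφ x)]
  ring

/-- A test function which is one on the support of a given function. -/
theorem exists_isTest_eq_one {K : Set (Sp n)} (hK : Bornology.IsBounded K) :
    ∃ ψ : Sp n → ℝ, IsTest ψ ∧ ∀ x ∈ K, ψ x = 1 := by
  obtain ⟨R, hR, hKR⟩ := hK.subset_closedBall_lt 0 0
  let b : ContDiffBump (0 : Sp n) := ⟨R, R + 1, hR, by linarith⟩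
  exact ⟨b, ⟨b.contDiff, b.hasCompactSupport⟩, fun x hx => b.one_of_mem_closedBall (hKR hx)⟩

/-- The energy symmetry of 1_B is tested on the pair φ, x_j φ, and each side is integrated by parts
onto the smooth factor. -/
theorem setIntegral_partialDeriv_sq [IsFiniteMeasure (weighted ρ S)]
    (hρ : ContDiff ℝ 1 ρ) (hρ_pos : ∀ x, 0 < ρ x)
    {hB : MeasurableSet B} (hinv : IsInvariant (formDomain ρ S) (form ρ S) hB) {φ : Sp n → ℝ}
    (hφ : IsTest φ) (j : Fin (n + 1)) :
    ∫ x in B, partialDeriv j (fun y => ρ y * (φ y * φ y)) x = 0 := by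
  obtain ⟨Q, hQ, hQs⟩ := exists_cutoff_energySpace hρ hρ_pos hinv
  have hg := isTest_coord_mul hφ j
  have key : ∀ {φ g : Sp n → ℝ} (hφ : IsTest φ) (hg : IsTest g),
      ⟪toGrad ρ S (Q (ofTest ρ S hφ)), toGrad ρ S (ofTest ρ S hg)⟫_ℝ =
        -∫ x in B, φ x * divGrad ρ g x := by
    intro φ g hφ hg
    rw [inner_toGrad_ofTest hρ hρ_pos, hQ, ← integral_indicator hB]
    congr 1
    refine integral_congr_ae ?_
    filter_upwards [(volume_absolutelyContinuous_volWeighted hρ hρ_pos).ae_le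
      (ae_mono (volWeighted_le ρ S) (toFn_ofTest (S := S) hφ)),
      (volume_absolutelyContinuous_volWeighted hρ hρ_pos).ae_le
      (ae_mono (volWeighted_le ρ S) (coeFn_cutoff hB (toFn ρ S (ofTest ρ S hφ))))] with x h1 h2
    rw [h2]
    by_cases hx : x ∈ B <;> simp [hx, h1]
  have h := hQs (ofTest ρ S hφ) (ofTest ρ S hg)
  rw [real_inner_comm (toGrad ρ S (Q (ofTest ρ S hg))), key, key, neg_inj] at h
  have hi : ∀ {φ g : Sp n → ℝ} (hφ : IsTest φ) (hg : IsTest g),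
      Integrable (fun x => φ x * divGrad ρ g x) (volume.restrict B) := fun hφ hg =>
    ((hφ.1.continuous.mul (continuous_divGrad hρ hg)).integrable_of_hasCompactSupport
      hφ.2.mul_right).restrict
  rw [← sub_eq_zero, ← integral_sub (hi hφ hg) (hi hg hφ)] at h
  simpa only [divGrad_coord_mul hρ hφ j] using h

/-- Polarization: if ψ = 1 on the support of φ, then (φ+ψ)² - (φ-ψ)² = 4φψ = 4φ. -/
theorem setIntegral_partialDeriv_of_isTest [IsFiniteMeasure (weighted ρ S)]
    (hρ : ContDiff ℝ 1 ρ) (hρ_pos : ∀ x, 0 < ρ x)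
    {hB : MeasurableSet B} (hinv : IsInvariant (formDomain ρ S) (form ρ S) hB) {φ : Sp n → ℝ}
    (hφ : IsTest φ) (j : Fin (n + 1)) :
    ∫ x in B, partialDeriv j (fun y => ρ y * φ y) x = 0 := by
  obtain ⟨ψ, hψ, hψ1⟩ := exists_isTest_eq_one hφ.2.isCompact.isBounded
  have hsq : ∀ y, φ y * ψ y = φ y := fun y => by
    by_cases hy : y ∈ tsupport φ
    · rw [hψ1 y hy, mul_one]
    · rw [image_eq_zero_of_notMem_tsupport hy, zero_mul]
  have h1 := setIntegral_partialDeriv_sq hρ hρ_pos hinv (hφ.add hψ) j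
  have h2 := setIntegral_partialDeriv_sq hρ hρ_pos hinv (hφ.sub hψ) j
  have hC : ∀ {η : Sp n → ℝ}, IsTest η → ContDiff ℝ 1 fun y => ρ y * (η y * η y) := fun hη =>
    hρ.mul (hη.contDiff_one.mul hη.contDiff_one)
  have hi : ∀ {η : Sp n → ℝ}, IsTest η → Integrable
      (partialDeriv j (fun y => ρ y * (η y * η y))) (volume.restrict B) := fun hη =>
    ((continuous_partialDeriv j (hC hη)).integrable_of_hasCompactSupport
      (hasCompactSupport_partialDeriv j hη.2.mul_left.mul_left)).restrict
  have h3 := integral_sub (hi (hφ.add hψ)) (hi (hφ.sub hψ))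
  rw [h1, h2, sub_zero] at h3
  have h4 : ∀ x, partialDeriv j (fun y => ρ y * ((φ + ψ) y * (φ + ψ) y)) x -
      partialDeriv j (fun y => ρ y * ((φ - ψ) y * (φ - ψ) y)) x =
      4 * partialDeriv j (fun y => ρ y * φ y) x := fun x => by
    rw [← partialDeriv_sub j ((hC (hφ.add hψ)).differentiable one_ne_zero x)
      ((hC (hφ.sub hψ)).differentiable one_ne_zero x), ← partialDeriv_const_mul j _
      ((hρ.mul hφ.contDiff_one).differentiable one_ne_zero x)]
    congr 1
    funext y
    rw [← hsq y]
    simp only [Pi.add_apply, Pi.sub_apply]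
    ring
  simp only [h4, integral_const_mul] at h3
  linarith

/-- Mollification of a continuously differentiable function with compact support. -/
theorem exists_isTest_approx {η : Sp n → ℝ} (hη : ContDiff ℝ 1 η) (hηc : HasCompactSupport η)
    {ε : ℝ} (hε : 0 < ε) :
    ∃ φ : Sp n → ℝ, IsTest φ ∧ tsupport φ ⊆ Metric.cthickening 1 (tsupport η) ∧
      (∀ x, |φ x - η x| ≤ ε) ∧ ∀ i x, |partialDeriv i φ x - partialDeriv i η x| ≤ ε := by
  have hu : ∃ δ > 0, ∀ x y, dist x y < δ → dist (η x) (η y) < ε :=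
    Metric.uniformContinuous_iff.1 (hη.continuous.uniformContinuous_of_tendsto_cocompact hηc.is_zero_at_infty) ε hε |>.imp
      fun δ h => ⟨h.1, fun x y => @h.2 x y⟩
  have hu' : ∀ i, ∃ δ > 0, ∀ x y, dist x y < δ →
      dist (partialDeriv i η x) (partialDeriv i η y) < ε := fun i =>
    Metric.uniformContinuous_iff.1
      ((continuous_partialDeriv i hη).uniformContinuous_of_tendsto_cocompact
        (hasCompactSupport_partialDeriv i hηc).is_zero_at_infty) ε hε |>.imp
      fun δ h => ⟨h.1, fun x y => @h.2 x y⟩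
  obtain ⟨δ, hδ, h⟩ := hu
  choose δ' hδ' h' using hu'
  obtain ⟨r, hr, hrδ, hr1, hrδ'⟩ : ∃ r > 0, r ≤ δ ∧ r ≤ 1 ∧ ∀ i, r ≤ δ' i := by
    obtain ⟨i, -, hi⟩ := Finset.exists_min_image Finset.univ δ' ⟨0, Finset.mem_univ _⟩
    exact ⟨min (min δ 1) (δ' i), lt_min (lt_min hδ one_pos) (hδ' i),
      (min_le_left _ _).trans (min_le_left _ _), (min_le_left _ _).trans (min_le_right _ _),
      fun j => (min_le_right _ _).trans (hi j (Finset.mem_univ _))⟩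
  let b : ContDiffBump (0 : Sp n) := ⟨r / 2, r, by positivity, by linarith⟩
  have hbc : HasCompactSupport (b.normed volume) := b.hasCompactSupport_normed
  have hli : LocallyIntegrable η (volume : Measure (Sp n)) := hη.continuous.locallyIntegrable
  have hlb : LocallyIntegrable (b.normed volume) (volume : Measure (Sp n)) :=
    b.continuous_normed.locallyIntegrable
  have hD : ∀ i x, partialDeriv i (convolution (b.normed volume) η (.lsmul ℝ ℝ) volume) x =
      convolution (b.normed volume) (partialDeriv i η) (.lsmul ℝ ℝ) volume x := fun i x => by
    rw [partialDeriv, (hηc.hasFDerivAt_convolution_right (.lsmul ℝ ℝ) hlb hη x).fderiv,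
      convolution_precompR_apply _ hlb (hηc.fderiv ℝ) (hη.continuous_fderiv one_ne_zero)]
    rfl
  refine ⟨convolution (b.normed volume) η (.lsmul ℝ ℝ) volume,
    ⟨hbc.contDiff_convolution_left _ b.contDiff_normed hli, hbc.convolution _ hηc⟩, ?_, ?_, ?_⟩
  · refine closure_minimal ?_ Metric.isClosed_cthickening
    refine (support_convolution_subset _).trans ?_
    rintro _ ⟨y, hy, z, hz, rfl⟩
    refine Metric.mem_cthickening_of_dist_le _ z _ _ (subset_tsupport η hz) ?_
    rw [b.support_normed_eq, Metric.mem_ball, dist_zero_right] at hy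
    simpa using hy.le.trans hr1
  · intro x
    exact b.dist_normed_convolution_le hη.continuous.aestronglyMeasurable
      fun y hy => (h y x (lt_of_lt_of_le hy hrδ)).le
  · intro i x
    rw [hD]
    exact b.dist_normed_convolution_le (continuous_partialDeriv i hη).aestronglyMeasurable
      fun y hy => (h' i y x (lt_of_lt_of_le hy (hrδ' i))).le

/-- Test functions approximate η in C¹ with supports in one fixed compact set, so the error is ε
times a constant. -/
theorem setIntegral_partialDeriv_weighted [IsFiniteMeasure (weighted ρ S)]
    (hρ : ContDiff ℝ 1 ρ) (hρ_pos : ∀ x, 0 < ρ x)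
    {hB : MeasurableSet B} (hinv : IsInvariant (formDomain ρ S) (form ρ S) hB) {η : Sp n → ℝ}
    (hη : ContDiff ℝ 1 η) (hηc : HasCompactSupport η) (j : Fin (n + 1)) :
    ∫ x in B, partialDeriv j (fun y => ρ y * η y) x = 0 := by
  set K := Metric.cthickening 1 (tsupport η) with hK
  have hKc : IsCompact K := hηc.isCompact.cthickening
  have hKη : tsupport η ⊆ K := Metric.self_subset_cthickening _
  obtain ⟨C, hC⟩ := hKc.exists_bound_of_continuousOn (f := fun x => |ρ x| + |partialDeriv j ρ x|)
    ((hρ.continuous.abs.add (continuous_partialDeriv j hρ).abs).continuousOn)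
  have hle : ∀ ε > 0, ‖∫ x in B, partialDeriv j (fun y => ρ y * η y) x‖ ≤
      ε * (C * volume.real K) := by
    intro ε hε
    obtain ⟨φ, hφ, hφK, h1, h2⟩ := exists_isTest_approx hη hηc hε
    have hi : ∀ {g : Sp n → ℝ}, ContDiff ℝ 1 g → HasCompactSupport g →
        Integrable (partialDeriv j fun y => ρ y * g y) (volume.restrict B) := fun hg hgc =>
      ((continuous_partialDeriv j (hρ.mul hg)).integrable_of_hasCompactSupport
        (hasCompactSupport_partialDeriv j hgc.mul_left)).restrict
    have h3 := integral_sub (hi hη hηc) (hi hφ.contDiff_one hφ.2)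
    rw [setIntegral_partialDeriv_of_isTest hρ hρ_pos hinv hφ j, sub_zero] at h3
    rw [← h3]
    have hz : ∀ g : Sp n → ℝ, tsupport g ⊆ K → ∀ x ∉ K,
        partialDeriv j (fun y => ρ y * g y) x = 0 := fun g hg x hx => by
      have : x ∉ tsupport fun y => ρ y * g y := fun h =>
        hx (hg (closure_mono (Function.support_mul_subset_right _ _) h))
      rw [partialDeriv, fderiv_of_notMem_tsupport ℝ this]; rfl
    have hb : ∀ x ∈ K, ‖partialDeriv j (fun y => ρ y * η y) x -
        partialDeriv j (fun y => ρ y * φ y) x‖ ≤ ε * C := fun x hx => by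
      rw [partialDeriv_mul j (hρ.differentiable one_ne_zero x) (hη.differentiable one_ne_zero x),
        partialDeriv_mul j (hρ.differentiable one_ne_zero x)
          (hφ.contDiff_one.differentiable one_ne_zero x)]
      have e : ρ x * partialDeriv j η x + partialDeriv j ρ x * η x -
          (ρ x * partialDeriv j φ x + partialDeriv j ρ x * φ x) =
          -(ρ x * (partialDeriv j φ x - partialDeriv j η x) +
            partialDeriv j ρ x * (φ x - η x)) := by ring
      rw [e, norm_neg]
      refine (norm_add_le _ _).trans ?_
      rw [norm_mul, norm_mul]
      simp only [Real.norm_eq_abs]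
      have h4 := hC x hx
      rw [Real.norm_of_nonneg (by positivity)] at h4
      calc |ρ x| * |partialDeriv j φ x - partialDeriv j η x| +
            |partialDeriv j ρ x| * |φ x - η x|
          ≤ |ρ x| * ε + |partialDeriv j ρ x| * ε := by
            gcongr
            exacts [h2 j x, h1 x]
        _ = ε * (|ρ x| + |partialDeriv j ρ x|) := by ring
        _ ≤ ε * C := by gcongr
    have hKB : ∫ x in B, (partialDeriv j (fun y => ρ y * η y) x -
        partialDeriv j (fun y => ρ y * φ y) x) = ∫ x in K, (partialDeriv j (fun y => ρ y * η y) x -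
        partialDeriv j (fun y => ρ y * φ y) x) ∂(volume.restrict B) := by
      refine (setIntegral_eq_integral_of_forall_compl_eq_zero fun x hx => ?_).symm
      rw [hz η hKη x hx, hz φ hφK x hx, sub_zero]
    rw [hKB, Measure.restrict_restrict hKc.measurableSet]
    have hfin : volume (K ∩ B) < ⊤ := (measure_mono inter_subset_left).trans_lt hKc.measure_lt_top
    refine (norm_setIntegral_le_of_norm_le_const hfin fun x hx => hb x hx.1).trans ?_
    rw [mul_assoc]
    rcases K.eq_empty_or_nonempty with h0 | ⟨x, hx⟩
    · simp [h0]
    · have hC0 : 0 ≤ C := (norm_nonneg _).trans (hC x hx)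
      gcongr
      · exact hKc.measure_lt_top.ne
      · exact inter_subset_left
  have ht : Tendsto (fun ε : ℝ => ε * (C * volume.real K)) (𝓝[>] 0) (𝓝 0) := by
    have : Continuous fun ε : ℝ => ε * (C * volume.real K) := by fun_prop
    simpa using (this.tendsto 0).mono_left nhdsWithin_le_nhds
  rw [← norm_le_zero_iff]
  exact ge_of_tendsto ht (eventually_mem_nhdsWithin.mono fun ε hε => hle ε hε)

/-- The weight is removed by using η/ϱ, which is only C¹; this is why the preceding identity has to
go beyond smooth functions. -/
theorem setIntegral_partialDeriv [IsFiniteMeasure (weighted ρ S)]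
    (hρ : ContDiff ℝ 1 ρ) (hρ_pos : ∀ x, 0 < ρ x)
    {hB : MeasurableSet B} (hinv : IsInvariant (formDomain ρ S) (form ρ S) hB) {η : Sp n → ℝ}
    (hη : ContDiff ℝ 1 η) (hηc : HasCompactSupport η) (j : Fin (n + 1)) :
    ∫ x in B, partialDeriv j η x = 0 := by
  have h := setIntegral_partialDeriv_weighted hρ hρ_pos hinv (η := fun y => η y * (ρ y)⁻¹)
    (hη.mul (hρ.inv fun y => (hρ_pos y).ne')) hηc.mul_right j
  have e : (fun y => ρ y * (η y * (ρ y)⁻¹)) = η := by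
    funext y
    have := (hρ_pos y).ne'
    field_simp
  rwa [e] at h

/-- A set whose indicator has vanishing weak gradient is null or conull. -/
theorem volume_eq_zero_or_of_setIntegral_partialDeriv (hB : MeasurableSet B)
    (h : ∀ η : Sp n → ℝ, ContDiff ℝ 1 η → HasCompactSupport η → ∀ j,
      ∫ x in B, partialDeriv j η x = 0) :
    volume B = 0 ∨ volume Bᶜ = 0 := by
  let b : ℕ → ContDiffBump (0 : Sp n) := fun k =>
    ⟨1 / (2 * (k + 1)), 1 / (k + 1), by positivity, by gcongr; linarith⟩
  set f : Sp n → ℝ := B.indicator fun _ => 1 with hf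
  have hfl : LocallyIntegrable f volume := (locallyIntegrable_const (1 : ℝ)).indicator hB
  -- The derivative of the mollified indicator at x is, up to sign, the integral over `B` of a
  -- derivative of the reflected bump, which vanishes by `h`.
  have hconst : ∀ k x, convolution ((b k).normed volume) f (.lsmul ℝ ℝ) volume x =
      convolution ((b k).normed volume) f (.lsmul ℝ ℝ) volume 0 := by
    intro k x
    have hc : HasCompactSupport ((b k).normed volume) := (b k).hasCompactSupport_normed
    have hs : ContDiff ℝ 1 ((b k).normed volume) := (b k).contDiff_normed
    simp only [← convolution_flip (L := .lsmul ℝ ℝ) (f := (b k).normed volume)]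
    have hd := fun x => hc.hasFDerivAt_convolution_right (ContinuousLinearMap.lsmul ℝ ℝ).flip hfl hs x
    refine is_const_of_fderiv_eq_zero (𝕜 := ℝ) (fun x => (hd x).differentiableAt) (fun x => ?_) x 0
    rw [(hd x).fderiv]
    refine ContinuousLinearMap.coe_injective ((EuclideanSpace.basisFun _ ℝ).toBasis.ext fun j => ?_)
    rw [ContinuousLinearMap.coe_coe, convolution_precompR_apply _ hfl (hc.fderiv ℝ)
      (hs.continuous_fderiv one_ne_zero)]
    have h1 := h (fun t => (b k).normed volume (x - t)) (hs.comp (contDiff_const.sub contDiff_id))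
      (hc.comp_homeomorph (Homeomorph.subLeft x)) j
    have h2 : ∀ t, partialDeriv j (fun t => (b k).normed volume (x - t)) t =
        -partialDeriv j ((b k).normed volume) (x - t) := fun t => by
      have : HasFDerivAt (fun t => (b k).normed volume (x - t)) _ t :=
        (hs.differentiable one_ne_zero (x - t)).hasFDerivAt.comp t
        ((hasFDerivAt_const x t).sub (hasFDerivAt_id t))
      rw [partialDeriv, this.fderiv]
      simp [partialDeriv]
    simp only [h2, integral_neg, neg_eq_zero] at h1
    rw [← integral_indicator hB] at h1
    simp only [convolution_def, OrthonormalBasis.coe_toBasis, EuclideanSpace.basisFun_apply]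
    refine Eq.trans (integral_congr_ae (.of_forall fun t => ?_)) h1
    by_cases ht : t ∈ B <;> simp [hf, ht, partialDeriv]
  -- Almost every point is a limit point of the mollifications in value. As these are constants, the
  -- indicator takes the same value at any two such points. The bounded ratio 2 of outer to inner
  -- radius is required here.
  have hae := ContDiffBump.ae_convolution_tendsto_right_of_locallyIntegrable (φ := b) (l := atTop)
    (K := 2) (g := f) (μ := volume) (by
      exact tendsto_one_div_add_atTop_nhds_zero_nat) (.of_forall fun k => by
      simp only [b]; apply le_of_eq; field_simp) hfl
  have hval : ∀ x y, Tendsto (fun k => convolution ((b k).normed volume) f (.lsmul ℝ ℝ) volume x)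
      atTop (𝓝 (f x)) → Tendsto
      (fun k => convolution ((b k).normed volume) f (.lsmul ℝ ℝ) volume y) atTop (𝓝 (f y)) →
      f x = f y := fun x y hx hy => by
    refine tendsto_nhds_unique (hx.congr fun k => hconst k x) (hy.congr fun k => hconst k y)
  by_contra! hcon
  obtain ⟨x, hxB, hx⟩ := (frequently_ae_mem_iff.2 hcon.1).and_eventually hae |>.exists
  obtain ⟨y, hyB, hy⟩ := (frequently_ae_mem_iff.2 hcon.2).and_eventually hae |>.exists
  have := hval x y hx hy
  rw [hf, indicator_of_mem hxB, indicator_of_notMem hyB] at this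
  exact one_ne_zero this

end Constancy

/-! ### The trace inequality in a graph chart -/

namespace GraphChart

variable {n : ℕ} (c : GraphChart n)

/-- The inclusion of the first `n` coordinates. -/
def incl : EuclideanSpace ℝ (Fin n) →L[ℝ] Sp n :=
  ∑ j : Fin n, (EuclideanSpace.proj j : EuclideanSpace ℝ (Fin n) →L[ℝ] ℝ).smulRight
    (c.basis j.castSucc)

/-- The vertical unit vector. -/
def vert : Sp n := c.basis (Fin.last n)

/-- The point over `y` at height `s` over the graph. -/
def param (y : EuclideanSpace ℝ (Fin n)) (s : ℝ) : Sp n := c.incl y + (c.graph y + s) • c.vert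

/-- The open cuboid. -/
def box : Set (EuclideanSpace ℝ (Fin n)) := {y | ∀ j, c.lo j < y j ∧ y j < c.hi j}

theorem repr_incl_castSucc (y : EuclideanSpace ℝ (Fin n)) (j : Fin n) :
    c.basis.repr (c.incl y) j.castSucc = y j := by
  simp [incl, OrthonormalBasis.repr_self, Pi.single_apply]

theorem repr_incl_last (y : EuclideanSpace ℝ (Fin n)) :
    c.basis.repr (c.incl y) (Fin.last n) = 0 := by
  simp [incl, OrthonormalBasis.repr_self]

theorem incl_add_smul (y : EuclideanSpace ℝ (Fin n)) (t : ℝ) : c.incl y + t • c.vert =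
    c.basis.repr.symm (WithLp.toLp 2
      ((MeasurableEquiv.piFinSuccAbove (fun _ => ℝ) (Fin.last n)).symm (t, WithLp.ofLp y))) := by
  rw [LinearIsometryEquiv.eq_symm_apply]
  ext i
  refine Fin.lastCases ?_ (fun j => ?_) i
  · simp [repr_incl_last, vert]
  · simp [repr_incl_castSucc, vert]

theorem base_param (y : EuclideanSpace ℝ (Fin n)) (s : ℝ) : c.base (c.param y s) = y := by
  ext j
  simp [base, param, repr_incl_castSucc, vert]

theorem offset_param (y : EuclideanSpace ℝ (Fin n)) (s : ℝ) : c.offset (c.param y s) = s := by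
  rw [offset, base_param]
  simp [param, repr_incl_last, vert]

theorem param_base_offset (v : Sp n) : c.param (c.base v) (c.offset v) = v := by
  apply c.basis.repr.injective
  ext i
  refine Fin.lastCases ?_ (fun j => ?_) i
  · simp [param, offset, repr_incl_last, vert]
  · simp [param, repr_incl_castSucc, vert, base]

theorem continuous_graph : Continuous c.graph := c.lipschitz.choose_spec.continuous

theorem continuous_param : Continuous fun p : EuclideanSpace ℝ (Fin n) × ℝ => c.param p.1 p.2 := by
  have := c.continuous_graph
  unfold param
  fun_prop

theorem exists_lipschitz_param : ∃ K : ℝ≥0, LipschitzWith K fun y => c.param y 0 := by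
  obtain ⟨K, hK⟩ := c.lipschitz
  have h := c.incl.lipschitz.add ((ContinuousLinearMap.toSpanSingleton ℝ c.vert).lipschitz.comp hK)
  exact ⟨_, by simpa [param, Function.comp_def] using h⟩

theorem continuous_base : Continuous c.base := by
  unfold base
  fun_prop

theorem continuous_offset : Continuous c.offset := by
  have := c.continuous_graph
  have := c.continuous_base
  unfold offset
  fun_prop

theorem isOpen_box : IsOpen c.box := by
  have : c.box = ⋂ j, {y | c.lo j < y j ∧ y j < c.hi j} := by ext; simp [box]
  rw [this]
  refine isOpen_iInter_of_finite fun j => ?_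
  have hj : Continuous fun y : EuclideanSpace ℝ (Fin n) => y j := by fun_prop
  exact (isOpen_lt continuous_const hj).inter (isOpen_lt hj continuous_const)

theorem dom_eq : c.dom = c.base ⁻¹' c.box ∩ {v | |c.offset v| < c.height} := rfl

theorem isOpen_dom : IsOpen c.dom := by
  rw [dom_eq]
  exact (c.isOpen_box.preimage c.continuous_base).inter
    (isOpen_lt c.continuous_offset.abs continuous_const)

theorem isBounded_dom : Bornology.IsBounded c.dom := by
  have hc : IsCompact ((fun p : (Fin n → ℝ) × ℝ => c.param (WithLp.toLp 2 p.1) p.2) ''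
      (Icc c.lo c.hi ×ˢ Icc (-c.height) c.height)) := by
    refine (isCompact_Icc.prod isCompact_Icc).image ?_
    exact c.continuous_param.comp (by fun_prop :
      Continuous fun p : (Fin n → ℝ) × ℝ => (WithLp.toLp 2 p.1, p.2))
  refine hc.isBounded.subset ?_
  rintro v ⟨h1, h2⟩
  have h3 := abs_lt.1 h2
  exact ⟨(WithLp.ofLp (c.base v), c.offset v),
    ⟨⟨fun j => (h1 j).1.le, fun j => (h1 j).2.le⟩, h3.1.le, h3.2.le⟩, c.param_base_offset v⟩

/-- A vertical shear followed by an orthonormal change of basis preserves volume; translation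
invariance in `s` removes the graph function. -/
theorem lintegral_param {F : Sp n → ℝ≥0∞} (hF : Measurable F) :
    ∫⁻ y, ∫⁻ s, F (c.param y s) = ∫⁻ v, F v := by
  have h1 : ∀ y, ∫⁻ s, F (c.param y s) = ∫⁻ t, F (c.incl y + t • c.vert) := fun y =>
    lintegral_add_left_eq_self (μ := volume) (fun t => F (c.incl y + t • c.vert)) (c.graph y)
  simp only [h1]
  have hm : MeasurePreserving (fun p : ℝ × EuclideanSpace ℝ (Fin n) =>
      c.incl p.2 + p.1 • c.vert) (volume.prod volume) volume := by
    have e1 : MeasurePreserving (Prod.map id (@WithLp.ofLp 2 (Fin n → ℝ)))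
        ((volume : Measure ℝ).prod volume) (volume.prod volume) :=
      (MeasurePreserving.id _).prod (PiLp.volume_preserving_ofLp (Fin n))
    have e2 := (volume_preserving_piFinSuccAbove (fun _ : Fin (n + 1) => ℝ) (Fin.last n)).symm
    have e3 := PiLp.volume_preserving_toLp (Fin (n + 1))
    have e4 := c.basis.measurePreserving_repr_symm
    have := e4.comp (e3.comp (e2.comp e1))
    convert! this using 1
    funext p
    exact c.incl_add_smul p.2 p.1
  rw [← hm.lintegral_comp hF]
  exact (lintegral_prod_symm _ (hF.comp hm.measurable).aemeasurable).symm

theorem norm_vert : ‖c.vert‖ = 1 := c.basis.norm_eq_one _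

/-- The fundamental theorem of calculus is applied to (1 - s/h) φ², whose weight is 1 on the graph
and 0 at the top; the cross term is split by 2|ab| ≤ a² + b². -/
theorem sq_param_zero_le {φ : Sp n → ℝ} (hφ : ContDiff ℝ 1 φ) (y : EuclideanSpace ℝ (Fin n)) :
    φ (c.param y 0) ^ 2 ≤ ∫ s in (0 : ℝ)..c.height,
      ((1 + 1 / c.height) * φ (c.param y s) ^ 2 + ‖gradient φ (c.param y s)‖ ^ 2) := by
  have hh := c.height_pos
  obtain ⟨h, hhe⟩ : ∃ h, h = c.height := ⟨_, rfl⟩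
  rw [← hhe] at hh ⊢
  have hp : ∀ s, HasDerivAt (c.param y) c.vert s := fun s => by
    have := (((hasDerivAt_id s).const_add (c.graph y)).smul_const c.vert).const_add (c.incl y)
    rw [one_smul] at this
    exact this
  have hpc : Continuous (c.param y) := continuous_iff_continuousAt.2 fun s => (hp s).continuousAt
  have hg : ∀ s, HasDerivAt (fun s => φ (c.param y s)) (fderiv ℝ φ (c.param y s) c.vert) s :=
    fun s => (hφ.differentiable one_ne_zero _).hasFDerivAt.comp_hasDerivAt s (hp s)
  have hd : ∀ s, HasDerivAt (fun s => (1 - s / h) * φ (c.param y s) ^ 2)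
      (-(1 / h) * φ (c.param y s) ^ 2 +
        (1 - s / h) * (2 * φ (c.param y s) * fderiv ℝ φ (c.param y s) c.vert)) s := fun s => by
    have h1 := (((hasDerivAt_id s).div_const h).const_sub 1).fun_mul ((hg s).fun_pow 2)
    refine h1.congr_deriv ?_
    simp
  have hc1 : Continuous fun s => φ (c.param y s) := hφ.continuous.comp hpc
  have hc2 : Continuous fun s => fderiv ℝ φ (c.param y s) c.vert :=
    ((hφ.continuous_fderiv one_ne_zero).comp hpc).clm_apply continuous_const
  have hc3 : Continuous fun s => gradient φ (c.param y s) := (continuous_gradient hφ).comp hpc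
  have hF := intervalIntegral.integral_eq_sub_of_hasDerivAt (a := 0) (b := h) (fun s _ => hd s)
    (Continuous.intervalIntegrable (by fun_prop) _ _)
  have e : φ (c.param y 0) ^ 2 = ∫ s in (0 : ℝ)..h, -(-(1 / h) * φ (c.param y s) ^ 2 +
        (1 - s / h) * (2 * φ (c.param y s) * fderiv ℝ φ (c.param y s) c.vert)) := by
    rw [intervalIntegral.integral_neg, hF, div_self hh.ne']
    simp
  rw [e]
  refine intervalIntegral.integral_mono_on hh.le (Continuous.intervalIntegrable (by fun_prop) _ _)
    (Continuous.intervalIntegrable (by fun_prop) _ _) fun s hs => ?_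
  have h1 : |fderiv ℝ φ (c.param y s) c.vert| ≤ ‖gradient φ (c.param y s)‖ := by
    rw [← inner_gradient_left]
    exact (abs_real_inner_le_norm _ _).trans_eq (by rw [norm_vert, mul_one])
  have h2 : (fderiv ℝ φ (c.param y s) c.vert) ^ 2 ≤ ‖gradient φ (c.param y s)‖ ^ 2 := by
    rw [← sq_abs]; exact pow_le_pow_left₀ (abs_nonneg _) h1 2
  have h3 : 0 ≤ 1 - s / h := sub_nonneg.2 ((div_le_one hh).2 hs.2)
  have h4 : 1 - s / h ≤ 1 := sub_le_self _ (div_nonneg hs.1 hh.le)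
  obtain ⟨a, ha⟩ : ∃ a, a = φ (c.param y s) := ⟨_, rfl⟩
  obtain ⟨b, hb⟩ : ∃ b, b = fderiv ℝ φ (c.param y s) c.vert := ⟨_, rfl⟩
  obtain ⟨t, ht⟩ : ∃ t, t = 1 - s / h := ⟨_, rfl⟩
  rw [← ha, ← ht, ← hb]
  rw [← hb] at h2
  rw [← ht] at h3 h4
  have h5 : -(t * (2 * a * b)) ≤ a ^ 2 + b ^ 2 := by
    nlinarith [mul_nonneg h3 (sq_nonneg (a + b)),
      mul_nonneg (sub_nonneg.2 h4) (add_nonneg (sq_nonneg a) (sq_nonneg b))]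
  have h6 : (1 + 1 / h) * a ^ 2 = a ^ 2 + 1 / h * a ^ 2 := by ring
  rw [h6]
  linarith

/-- The trace inequality. -/
theorem lintegral_trace_le {φ : Sp n → ℝ} (hφ : ContDiff ℝ 1 φ) :
    ∫⁻ y in c.box, ENNReal.ofReal (φ (c.param y 0) ^ 2) ≤ ∫⁻ v in c.dom,
      ENNReal.ofReal ((1 + 1 / c.height) * φ v ^ 2 + ‖gradient φ v‖ ^ 2) := by
  have hh := c.height_pos
  have hΦ : Continuous fun v => (1 + 1 / c.height) * φ v ^ 2 + ‖gradient φ v‖ ^ 2 := by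
    have := hφ.continuous
    have := continuous_gradient hφ
    fun_prop
  set F : Sp n → ℝ≥0∞ := c.dom.indicator fun v =>
      ENNReal.ofReal ((1 + 1 / c.height) * φ v ^ 2 + ‖gradient φ v‖ ^ 2) with hF
  have hFm : Measurable F := (hΦ.measurable.ennreal_ofReal).indicator c.isOpen_dom.measurableSet
  rw [← lintegral_indicator c.isOpen_dom.measurableSet, ← hF, ← c.lintegral_param hFm,
    ← lintegral_indicator c.isOpen_box.measurableSet]
  refine lintegral_mono fun y => ?_
  by_cases hy : y ∈ c.box
  swap
  · rw [indicator_of_notMem hy]; exact zero_le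
  rw [indicator_of_mem hy]
  have hpc : Continuous (c.param y) := c.continuous_param.comp (by fun_prop : Continuous fun s => (y, s))
  have hint : IntegrableOn (fun s => (1 + 1 / c.height) * φ (c.param y s) ^ 2 +
      ‖gradient φ (c.param y s)‖ ^ 2) (Ioo 0 c.height) :=
    ((hΦ.comp hpc).integrableOn_Icc (a := 0) (b := c.height)).mono_set Ioo_subset_Icc_self
  refine (ENNReal.ofReal_le_ofReal (c.sq_param_zero_le hφ y)).trans ?_
  rw [intervalIntegral.integral_of_le hh.le, integral_Ioc_eq_integral_Ioo,
    ofReal_integral_eq_lintegral_ofReal hint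
      (.of_forall fun s => by positivity),
    ← lintegral_indicator measurableSet_Ioo]
  refine lintegral_mono fun s => ?_
  by_cases hs : s ∈ Ioo 0 c.height
  swap
  · rw [indicator_of_notMem hs]; exact zero_le
  have hmem : c.param y s ∈ c.dom := by
    rw [dom_eq, mem_inter_iff, mem_preimage, base_param, mem_ofPred_eq, offset_param,
      abs_of_pos hs.1]
    exact ⟨hy, hs.2⟩
  rw [indicator_of_mem hs, hF, indicator_of_mem hmem]

end GraphChart

/-! ### Lebesgue null invariant sets do not charge a chart -/

section Trace

variable {n : ℕ} {ρ : Sp n → ℝ} {S : Measure (Sp n)} {B : Set (Sp n)}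

/-- Where the density is bounded below by δ, unweighted integrals are controlled by weighted ones.
-/
theorem restrict_le_smul_withDensity {μ : Measure (Sp n)} (hρ : ContDiff ℝ 1 ρ) {D : Set (Sp n)}
    {δ : ℝ} (hδ : 0 < δ) (h : ∀ x ∈ D, δ ≤ ρ x) :
    μ.restrict D ≤ (ENNReal.ofReal δ)⁻¹ • μ.withDensity fun x => ENNReal.ofReal (ρ x) := by
  have h0 : ENNReal.ofReal δ ≠ 0 := by simpa using hδ
  refine Measure.le_iff.2 fun s hs => ?_
  rw [Measure.restrict_apply hs, Measure.smul_apply, withDensity_apply _ hs, smul_eq_mul,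
    ← ENNReal.mul_le_iff_le_inv h0 ENNReal.ofReal_ne_top]
  calc ENNReal.ofReal δ * μ (s ∩ D) = ∫⁻ x in s ∩ D, ENNReal.ofReal δ ∂μ := by
        rw [setLIntegral_const]
    _ ≤ ∫⁻ x in s ∩ D, ENNReal.ofReal (ρ x) ∂μ :=
        setLIntegral_mono hρ.continuous.measurable.ennreal_ofReal
          fun x hx => ENNReal.ofReal_le_ofReal (h x hx.2)
    _ ≤ ∫⁻ x in s, ENNReal.ofReal (ρ x) ∂μ := lintegral_mono_set inter_subset_left

theorem lintegral_sq_eq {E : Type*} [NormedAddCommGroup E] {μ : Measure (Sp n)} (f : Sp n → E) :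
    ∫⁻ x, ENNReal.ofReal (‖f x‖ ^ 2) ∂μ = eLpNorm f 2 μ ^ 2 := by
  have h := eLpNorm_nnreal_pow_eq_lintegral (f := f) (μ := μ) (p := 2) two_ne_zero
  simp only [NNReal.coe_ofNat, ENNReal.rpow_two, ENNReal.coe_ofNat] at h
  rw [h]
  refine lintegral_congr fun x => ?_
  rw [ENNReal.ofReal_pow (norm_nonneg _), ofReal_norm]

variable [IsFiniteMeasure (weighted ρ S)]

/-- A set which is Lebesgue null and acts on the energy space does not meet the graph of a chart
in a set of positive measure. -/
theorem measure_inter_chart_eq_zero (hρ : ContDiff ℝ 1 ρ) (hρ_pos : ∀ x, 0 < ρ x)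
    (hB : MeasurableSet B) (hB0 : volume B = 0)
    (hQ : ∀ φ, IsTest φ → ∃ x, toFn ρ S x =ᵐ[weighted ρ S] B.indicator φ)
    (c : GraphChart n) {Q : Set (Sp n)} (hQm : MeasurableSet Q) (hQd : Q ⊆ c.dom) {C : ℝ≥0∞}
    (hC : C ≠ ⊤) (hSQ : S.restrict Q ≤ C • (volume.restrict c.box).map fun y => c.param y 0) :
    S (B ∩ Q) = 0 := by
  obtain ⟨φ, hφ, hφ1⟩ := exists_isTest_eq_one c.isBounded_dom
  obtain ⟨x, hx⟩ := hQ φ hφ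
  have hBφ : B.indicator φ =ᵐ[volume] 0 := by
    have : ∀ᵐ y ∂(volume : Measure (Sp n)), y ∉ B := measure_eq_zero_iff_ae_notMem.1 hB0
    filter_upwards [this] with y hy
    rw [indicator_of_notMem hy]; rfl
  have hvol : ∀ {p : Sp n → Prop}, (∀ᵐ y ∂weighted ρ S, p y) → ∀ᵐ y, p y := fun h =>
    (volume_absolutelyContinuous_volWeighted hρ hρ_pos).ae_le (ae_mono (volWeighted_le ρ S) h)
  have hx0 : toGrad ρ S x = 0 := toGrad_eq_zero hρ hρ_pos (Filter.EventuallyEq.trans (hvol hx) hBφ)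
  obtain ⟨δ, hδ, hδρ⟩ : ∃ δ > 0, ∀ y ∈ c.dom, δ ≤ ρ y := by
    rcases c.dom.eq_empty_or_nonempty with h | h
    · exact ⟨1, one_pos, by simp [h]⟩
    · obtain ⟨y, -, hy⟩ := c.isBounded_dom.isCompact_closure.exists_isMinOn
        h.closure hρ.continuous.continuousOn
      exact ⟨ρ y, hρ_pos y, fun z hz => hy (subset_closure hz)⟩
  have hδ0 : (ENNReal.ofReal δ)⁻¹ ≠ ⊤ := ENNReal.inv_ne_top.2 (by simpa using hδ)
  obtain ⟨u, hu, hux⟩ := mem_closure_iff_seq_limit.1 (denseRange_ofTest x)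
  choose ψ hψ hψu using hu
  obtain rfl : u = fun k => ofTest ρ S (hψ k) := funext hψu
  obtain ⟨h1, h2⟩ := tendsto_energySpace.1 hux
  have ha : Tendsto (fun k => eLpNorm (ψ k - B.indicator φ) 2 (weighted ρ S)) atTop (𝓝 0) := by
    refine ((tendsto_toFn_ofTest hψ _).1 h1).congr fun k => eLpNorm_congr_ae ?_
    exact (ae_eq_refl _).sub hx
  have hb : Tendsto (fun k => eLpNorm (gradient (ψ k)) 2 (volWeighted ρ)) atTop (𝓝 0) := by
    rw [hx0, Lp.tendsto_Lp_iff_tendsto_eLpNorm'] at h2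
    refine h2.congr fun k => eLpNorm_congr_ae ?_
    have := (toGrad_ofTest (ρ := ρ) (S := S) (hψ k)).sub (Lp.coeFn_zero (Sp n) 2 (volWeighted ρ))
    simpa using this
  set M : ℝ≥0∞ := C * (ENNReal.ofReal (1 + 1 / c.height) + 1) * (ENNReal.ofReal δ)⁻¹ with hM
  -- On B ∩ Q one has 1 ≤ 2ψ² + 2(ψ - 1)². The second term is the L² error; the first is bounded by
  -- the trace inequality, whose right side sees ψ near zero because 1_B φ vanishes Lebesgue-a.e.
  have hle : ∀ k, S (B ∩ Q) ≤ 2 * (M * (eLpNorm (ψ k - B.indicator φ) 2 (weighted ρ S) ^ 2 +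
      eLpNorm (gradient (ψ k)) 2 (volWeighted ρ) ^ 2)) + 2 * ((ENNReal.ofReal δ)⁻¹ *
      eLpNorm (ψ k - B.indicator φ) 2 (weighted ρ S) ^ 2) := by
    intro k
    have hψm : Measurable fun y => ENNReal.ofReal (ψ k y ^ 2) :=
      ((hψ k).1.continuous.pow 2).measurable.ennreal_ofReal
    have e1 : ∫⁻ y in c.dom, ENNReal.ofReal (ψ k y ^ 2) ≤
        (ENNReal.ofReal δ)⁻¹ * eLpNorm (ψ k - B.indicator φ) 2 (weighted ρ S) ^ 2 := by
      have : ∫⁻ y in c.dom, ENNReal.ofReal (ψ k y ^ 2) =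
          ∫⁻ y in c.dom, ENNReal.ofReal (‖(ψ k - B.indicator φ) y‖ ^ 2) := by
        refine lintegral_congr_ae (ae_restrict_of_ae ?_)
        filter_upwards [hBφ] with y hy
        rw [Pi.sub_apply, hy, Pi.zero_apply, sub_zero, Real.norm_eq_abs, sq_abs]
      rw [this, ← lintegral_sq_eq, ← smul_eq_mul, ← lintegral_smul_measure]
      refine lintegral_mono' ((restrict_le_smul_withDensity hρ hδ hδρ).trans ?_) le_rfl
      exact fun s => mul_le_mul_right (volWeighted_le ρ S s) _
    have e2 : ∫⁻ y in c.dom, ENNReal.ofReal (‖gradient (ψ k) y‖ ^ 2) ≤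
        (ENNReal.ofReal δ)⁻¹ * eLpNorm (gradient (ψ k)) 2 (volWeighted ρ) ^ 2 := by
      rw [← lintegral_sq_eq, ← smul_eq_mul, ← lintegral_smul_measure]
      exact lintegral_mono' (restrict_le_smul_withDensity hρ hδ hδρ) le_rfl
    have e3 : ∫⁻ y in Q, ENNReal.ofReal (‖(ψ k - B.indicator φ) y‖ ^ 2) ∂S ≤
        (ENNReal.ofReal δ)⁻¹ * eLpNorm (ψ k - B.indicator φ) 2 (weighted ρ S) ^ 2 := by
      rw [← lintegral_sq_eq, ← smul_eq_mul, ← lintegral_smul_measure]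
      refine lintegral_mono' ((Measure.restrict_mono hQd (Measure.le_add_left le_rfl)).trans
        (restrict_le_smul_withDensity hρ hδ hδρ)) le_rfl
    have e4 : ∫⁻ y in Q, ENNReal.ofReal (ψ k y ^ 2) ∂S ≤
        M * (eLpNorm (ψ k - B.indicator φ) 2 (weighted ρ S) ^ 2 +
        eLpNorm (gradient (ψ k)) 2 (volWeighted ρ) ^ 2) := by
      have hγ : Measurable fun y => c.param y 0 :=
        (c.exists_lipschitz_param.choose_spec.continuous).measurable
      have hgm : Measurable fun y => ENNReal.ofReal (‖gradient (ψ k) y‖ ^ 2) :=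
        ((continuous_gradient (hψ k).contDiff_one).norm.pow 2).measurable.ennreal_ofReal
      have hh : (0 : ℝ) ≤ 1 + 1 / c.height := by have := c.height_pos; positivity
      calc ∫⁻ y in Q, ENNReal.ofReal (ψ k y ^ 2) ∂S
          ≤ C * ∫⁻ y in c.box, ENNReal.ofReal (ψ k (c.param y 0) ^ 2) := by
            rw [← lintegral_map hψm hγ, ← smul_eq_mul, ← lintegral_smul_measure]
            exact lintegral_mono' hSQ le_rfl
        _ ≤ C * ∫⁻ v in c.dom, ENNReal.ofReal
              ((1 + 1 / c.height) * ψ k v ^ 2 + ‖gradient (ψ k) v‖ ^ 2) := by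
            gcongr
            exact c.lintegral_trace_le (hψ k).contDiff_one
        _ = C * (ENNReal.ofReal (1 + 1 / c.height) * (∫⁻ v in c.dom, ENNReal.ofReal (ψ k v ^ 2)) +
              ∫⁻ v in c.dom, ENNReal.ofReal (‖gradient (ψ k) v‖ ^ 2)) := by
            rw [← lintegral_const_mul _ hψm, ← lintegral_add_right _ hgm]
            congr 1
            refine lintegral_congr fun v => ?_
            rw [ENNReal.ofReal_add (by positivity) (by positivity), ENNReal.ofReal_mul hh]
        _ ≤ C * (ENNReal.ofReal (1 + 1 / c.height) * ((ENNReal.ofReal δ)⁻¹ *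
              eLpNorm (ψ k - B.indicator φ) 2 (weighted ρ S) ^ 2) + ((ENNReal.ofReal δ)⁻¹ *
              eLpNorm (gradient (ψ k)) 2 (volWeighted ρ) ^ 2)) := by gcongr
        _ ≤ C * ((ENNReal.ofReal (1 + 1 / c.height) + 1) * ((ENNReal.ofReal δ)⁻¹ *
              eLpNorm (ψ k - B.indicator φ) 2 (weighted ρ S) ^ 2) +
              (ENNReal.ofReal (1 + 1 / c.height) + 1) * ((ENNReal.ofReal δ)⁻¹ *
              eLpNorm (gradient (ψ k)) 2 (volWeighted ρ) ^ 2)) := by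
            exact mul_le_mul' le_rfl (add_le_add (mul_le_mul' le_self_add le_rfl)
              (le_mul_of_one_le_left zero_le le_add_self))
        _ = _ := by rw [hM]; ring
    calc S (B ∩ Q) = ∫⁻ y in Q, B.indicator 1 y ∂S := by
          rw [lintegral_indicator_one hB, Measure.restrict_apply hB]
      _ ≤ ∫⁻ y in Q, (2 * ENNReal.ofReal (ψ k y ^ 2) +
            2 * ENNReal.ofReal (‖(ψ k - B.indicator φ) y‖ ^ 2)) ∂S := by
          refine setLIntegral_mono' hQm fun y hy => ?_
          by_cases hyB : y ∈ B
          swap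
          · rw [indicator_of_notMem hyB]; exact zero_le
          rw [indicator_of_mem hyB, Pi.sub_apply, indicator_of_mem hyB, hφ1 y (hQd hy),
            Pi.one_apply, ← ENNReal.ofReal_ofNat, ← ENNReal.ofReal_mul zero_le_two,
            ← ENNReal.ofReal_mul zero_le_two, ← ENNReal.ofReal_add (by positivity) (by positivity),
            ← ENNReal.ofReal_one, Real.norm_eq_abs, sq_abs]
          refine ENNReal.ofReal_le_ofReal ?_
          -- The difference 2a² + 2(a - 1)² - 1 equals (2a - 1)².
          nlinarith [sq_nonneg (2 * ψ k y - 1)]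
      _ = 2 * (∫⁻ y in Q, ENNReal.ofReal (ψ k y ^ 2) ∂S) +
            2 * ∫⁻ y in Q, ENNReal.ofReal (‖(ψ k - B.indicator φ) y‖ ^ 2) ∂S := by
          rw [lintegral_add_left (hψm.const_mul _), lintegral_const_mul _ hψm,
            lintegral_const_mul' _ _ (by simp)]
      _ ≤ _ := by gcongr
  have hMt : M ≠ ⊤ := ENNReal.mul_ne_top (ENNReal.mul_ne_top hC (by simp)) hδ0
  have hlim : Tendsto (fun k => 2 * (M * (eLpNorm (ψ k - B.indicator φ) 2 (weighted ρ S) ^ 2 +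
      eLpNorm (gradient (ψ k)) 2 (volWeighted ρ) ^ 2)) + 2 * ((ENNReal.ofReal δ)⁻¹ *
      eLpNorm (ψ k - B.indicator φ) 2 (weighted ρ S) ^ 2)) atTop (𝓝 0) := by
    have ha2 := ENNReal.Tendsto.pow (n := 2) ha
    have hb2 := ENNReal.Tendsto.pow (n := 2) hb
    rw [zero_pow two_ne_zero] at ha2 hb2
    have h3 := ENNReal.Tendsto.const_mul (ENNReal.Tendsto.const_mul (ha2.add hb2)
      (.inr hMt)) (.inr (ENNReal.ofNat_ne_top (n := 2)))
    have h4 := ENNReal.Tendsto.const_mul (ENNReal.Tendsto.const_mul ha2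
      (.inr hδ0)) (.inr (ENNReal.ofNat_ne_top (n := 2)))
    simpa using h3.add h4
  exact le_antisymm (ge_of_tendsto' hlim hle) zero_le

end Trace

/-! ### Comparison of the singular measure with the chart parametrization -/

section Charts

variable {n : ℕ}

/-- The set lies in the image of the box under a K-Lipschitz map, which enlarges n-dimensional
Hausdorff measure by at most K^n; the normalizing constant is common to both sides. -/
theorem exists_restrict_le_graph (c : GraphChart n) {Q : Set (Sp n)}
    (hQ : ∀ v ∈ Q, c.base v ∈ c.box ∧ c.offset v = 0) :
    ∃ C : ℝ≥0∞, C ≠ ⊤ ∧ (Measure.euclideanHausdorffMeasure n : Measure (Sp n)).restrict Q ≤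
      C • (volume.restrict c.box).map fun y => c.param y 0 := by
  obtain ⟨K, hK⟩ := c.exists_lipschitz_param
  refine ⟨(K : ℝ≥0∞) ^ (n : ℝ), ENNReal.rpow_ne_top_of_nonneg (by positivity) (by simp), ?_⟩
  refine Measure.le_iff.2 fun s hs => ?_
  have hγ : Measurable fun y => c.param y 0 := hK.continuous.measurable
  rw [Measure.restrict_apply hs, Measure.smul_apply, Measure.map_apply hγ hs,
    Measure.restrict_apply (hγ hs), smul_eq_mul,
    ← EuclideanSpace.euclideanHausdorffMeasure_eq_volume]
  have hsub : s ∩ Q ⊆ (fun y => c.param y 0) '' ((fun y => c.param y 0) ⁻¹' s ∩ c.box) := by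
    rintro v ⟨hv, hvQ⟩
    obtain ⟨h1, h2⟩ := hQ v hvQ
    have h3 : c.param (c.base v) 0 = v := by rw [← h2, c.param_base_offset]
    exact ⟨c.base v, ⟨by rw [mem_preimage, h3]; exact hv, h1⟩, h3⟩
  refine (measure_mono hsub).trans ?_
  simp only [Measure.euclideanHausdorffMeasure_def, Measure.smul_apply]
  rw [ENNReal.smul_def, ENNReal.smul_def, smul_eq_mul, smul_eq_mul, mul_left_comm]
  gcongr
  exact hK.hausdorffMeasure_image_le (by positivity) _

/-- The chart of a point on the line. -/
def pointChart (p : Sp 0) : GraphChart 0 where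
  basis := EuclideanSpace.basisFun _ ℝ
  height := 1
  height_pos := one_pos
  lo := 0
  hi := 0
  graph := fun _ => p 0
  lipschitz := ⟨0, LipschitzWith.const _⟩

theorem param_pointChart (p : Sp 0) (y : EuclideanSpace ℝ (Fin 0)) :
    (pointChart p).param y 0 = p := by
  ext i
  obtain rfl : i = 0 := Fin.ext (by omega)
  simp [GraphChart.param, GraphChart.incl, GraphChart.vert, pointChart]

theorem mem_dom_pointChart (p : Sp 0) : p ∈ (pointChart p).dom := by
  have h := GraphChart.offset_param (pointChart p) 0 0
  rw [param_pointChart] at h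
  exact ⟨fun j => j.elim0, by rw [h]; simp [pointChart]⟩

/-- For a zero-dimensional base, Lebesgue measure is a Dirac mass and its image is the Dirac mass at
`p`. -/
theorem restrict_singleton_le (p : Sp 0) (S : Measure (Sp 0)) : S.restrict {p} ≤
    S {p} • (volume.restrict (pointChart p).box).map fun y => (pointChart p).param y 0 := by
  have hbox : (pointChart p).box = univ := eq_univ_of_forall fun y j => j.elim0
  simp only [param_pointChart]
  rw [hbox, Measure.restrict_univ, Measure.map_const, volume_euclideanSpace_eq_dirac,
    Measure.restrict_singleton]
  simp

end Charts

/-- Countably many chart pieces cover `A`, and `S` vanishes off `A`. -/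
theorem measure_point_or_lipschitz_eq_zero {n : ℕ} {A : Set (Sp n)} {S : Measure (Sp n)}
    {ρ : Sp n → ℝ} [IsFiniteMeasure (weighted ρ S)] (hρ : ContDiff ℝ 1 ρ) (hρ_pos : ∀ x, 0 < ρ x)
    (hA : IsPointCase A S ∨ IsLipschitzCase A S) {B : Set (Sp n)}
    (hB : MeasurableSet B) (hB0 : volume B = 0)
    (hQ : ∀ φ, IsTest φ → ∃ x, toFn ρ S x =ᵐ[weighted ρ S] B.indicator φ) : S B = 0 := by
  rcases hA with ⟨rfl, N, x, -, -, hS⟩ | ⟨-, U, hU, -, ⟨l, c, hc, hcov⟩, rfl, hS⟩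
  · have hp : ∀ p, S (B ∩ {p}) = 0 := fun p => by
      refine measure_inter_chart_eq_zero hρ hρ_pos hB hB0 hQ (pointChart p)
        (measurableSet_singleton p) (singleton_subset_iff.2 (mem_dom_pointChart p)) ?_
        (restrict_singleton_le p S)
      -- The constant S {p} must be finite: ϱ(p) S {p} is at most the finite total mass of ϱμ, and
      -- ϱ(p) > 0.
      have h0 : ENNReal.ofReal (ρ p) ≠ 0 := by simpa using hρ_pos p
      have h1 : ENNReal.ofReal (ρ p) * S {p} ≤ weighted ρ S {p} := by
        rw [weighted, withDensity_apply _ (measurableSet_singleton p), lintegral_singleton]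
        gcongr
        exact Measure.le_add_left le_rfl
      intro h
      rw [h, ENNReal.mul_top h0] at h1
      exact (measure_lt_top (weighted ρ S) {p}).ne (top_le_iff.1 h1)
    have hcount : S (⋃ k : N, B ∩ {x k}) = 0 := measure_iUnion_null fun k => hp _
    have hcompl : S (⋃ k : N, {x k})ᶜ = 0 := by
      rw [hS, Measure.sum_apply _ (MeasurableSet.iUnion fun k => measurableSet_singleton _).compl,
        ENNReal.tsum_eq_zero]
      intro k
      rw [Measure.dirac_apply' _ (MeasurableSet.iUnion fun k => measurableSet_singleton _).compl,
        indicator_of_notMem]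
      exact fun h => h (mem_iUnion.2 ⟨k, rfl⟩)
    refine measure_mono_null (fun y hy => ?_) (measure_union_null hcount hcompl)
    by_cases h : y ∈ ⋃ k : N, ({x k} : Set (Sp 0))
    · obtain ⟨k, hk⟩ := mem_iUnion.1 h
      exact .inl (mem_iUnion.2 ⟨k, hy, hk⟩)
    · exact .inr h
  · have hfm : MeasurableSet (frontier U) := isClosed_frontier.measurableSet
    have hk : ∀ k, S (B ∩ (frontier U ∩ (c k).dom)) = 0 := fun k => by
      have hQm := hfm.inter (c k).isOpen_dom.measurableSet
      obtain ⟨C, hC, hle⟩ := exists_restrict_le_graph (c k) (Q := frontier U ∩ (c k).dom) fun v hv => by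
        refine ⟨hv.2.1, ?_⟩
        -- A frontier point of the open set U lies neither in U nor outside its closure, so only
        -- offset zero survives.
        rcases lt_trichotomy ((c k).offset v) 0 with h | h | h
        · exact absurd (frontier_subset_closure hv.1) ((hc k v hv.2).2.2 h)
        · exact h
        · exact absurd ((hc k v hv.2).2.1 h) (by
            rw [hU.frontier_eq] at hv; exact hv.1.2)
      refine measure_inter_chart_eq_zero hρ hρ_pos hB hB0 hQ (c k) hQm inter_subset_right hC
        (le_trans ?_ hle)
      rw [hS, Measure.restrict_restrict hQm]
      exact Measure.restrict_mono inter_subset_left le_rfl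
    have hcompl : S (frontier U)ᶜ = 0 := by
      rw [hS, Measure.restrict_apply hfm.compl, compl_inter_self, measure_empty]
    refine measure_mono_null (fun y hy => ?_) (measure_union_null (measure_iUnion_null hk) hcompl)
    by_cases h : y ∈ frontier U
    · obtain ⟨k, hk⟩ := mem_iUnion.1 (hcov h)
      exact .inl (mem_iUnion.2 ⟨k, hy, h, hk⟩)
    · exact .inr h

end StickyForm

end

/-! ### Irreducibility -/

theorem mainTheorem10 (n : ℕ) (A : Set (StickyForm.Sp n)) (S : MeasureTheory.Measure (StickyForm.Sp n))
    (ρ : StickyForm.Sp n → ℝ) (hρ_smooth : ContDiff ℝ 1 ρ) (hρ_pos : ∀ x, 0 < ρ x)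
    (hρ_int : MeasureTheory.Integrable ρ (MeasureTheory.volume + S))
    (hA : StickyForm.IsPointCase A S ∨ StickyForm.IsLipschitzCase A S) :
    StickyForm.IsIrreducible (StickyForm.formDomain ρ S) (StickyForm.form ρ S) := by
  intro B hB hinv
  have := StickyForm.isFiniteMeasure_weighted hρ_int
  obtain ⟨Q, hQ, -⟩ := StickyForm.exists_cutoff_energySpace hρ_smooth hρ_pos hinv
  have hnull : ∀ {T : Set (StickyForm.Sp n)}, volume T = 0 → S T = 0 →
      StickyForm.weighted ρ S T = 0 := fun h1 h2 =>
    withDensity_absolutelyContinuous _ _ (by rw [Measure.add_apply, h1, h2, add_zero])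
  have hQB : ∀ φ (hφ : StickyForm.IsTest φ), StickyForm.toFn ρ S
      (Q (StickyForm.ofTest ρ S hφ)) =ᵐ[StickyForm.weighted ρ S] B.indicator φ := fun φ hφ => by
    rw [hQ]
    filter_upwards [StickyForm.coeFn_cutoff hB (StickyForm.toFn ρ S (StickyForm.ofTest ρ S hφ)),
      StickyForm.toFn_ofTest (ρ := ρ) (S := S) hφ] with y h1 h2
    rw [h1]
    by_cases hy : y ∈ B <;> simp [hy, h2]
  rcases StickyForm.volume_eq_zero_or_of_setIntegral_partialDeriv hB fun η hη hηc j =>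
    StickyForm.setIntegral_partialDeriv hρ_smooth hρ_pos hinv hη hηc j with h0 | h0
  · exact .inl (hnull h0 (StickyForm.measure_point_or_lipschitz_eq_zero hρ_smooth hρ_pos hA hB h0
      fun φ hφ => ⟨_, hQB φ hφ⟩))
  -- For the complement, φ minus the image of φ under `Q` represents 1_{Bᶜ} φ in the energy space.
  · refine .inr (hnull h0 (StickyForm.measure_point_or_lipschitz_eq_zero hρ_smooth hρ_pos hA
      hB.compl h0 fun φ hφ => ⟨StickyForm.ofTest ρ S hφ - Q (StickyForm.ofTest ρ S hφ), ?_⟩))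
    rw [map_sub]
    filter_upwards [Lp.coeFn_sub (StickyForm.toFn ρ S (StickyForm.ofTest ρ S hφ))
      (StickyForm.toFn ρ S (Q (StickyForm.ofTest ρ S hφ))), hQB φ hφ,
      StickyForm.toFn_ofTest (ρ := ρ) (S := S) hφ] with y h1 h2 h3
    rw [h1, Pi.sub_apply, h2, h3, indicator_compl, Pi.sub_apply]
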